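/- Let $n\ge 1$ and let $M$ be a smooth connected (Hausdorff, second countable) manifold of dimension $2n+1$ with an almost contact metric structure $(\phi,\xi,\eta,g)$: smooth tensor fields, $g$ a Riemannian metric, with $\phi^2X=-X+\eta(X)\xi$, $\eta(\xi)=1$, $g(\phi X,\phi Y)=g(X,Y)-\eta(X)\eta(Y)$. Use the convention $2d\eta(X,Y)=X\eta(Y)-Y\eta(X)-\eta([X,Y])$, put $\Phi(X,Y)=g(X,\phi Y)$, $N_\phi(X,Y)=\phi^2[X,Y]+[\phi X,\phi Y]-\phi[\phi X,Y]-\phi[X,\phi Y]$ and $N^{(1)}=N_\phi+2d\eta\otimes\xi$, and assume that the structure is anti-quasi-Sasakian, i.e. $N^{(1)}=4d\eta\otimes\xi$ and $d\Phi=0$. Let $\nabla$ be the Levi-Civita connection of $g$, $R_{XY}Z=\nabla_X\nabla_YZ-\nabla_Y\nabla_XZ-\nabla_{[X,Y]}Z$, $S_\xi=-\nabla\xi$, and let $J_\xi X=R_{X\xi}\xi$ be the Jacobi operator of $\xi$. Then: 1. $g(J_\xi X,Z)=-g(X,S_\xi^2Z)$ for all vector fields $X,Z$; the form $g(J_\xi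 X,Z)$ is symmetric and positive semi-definite. 2. At every point the ranks of $S_\xi$ and $J_\xi$ are at most $2n$. The form $\eta$ is a contact form ($\eta\wedge(d\eta)^n\neq0$ everywhere) if and only if $S_\xi$ has rank $2n$ at every point, and in that case $J_\xi$ also has rank $2n$ at every point. 3. If $\eta$ is a contact form, then $M$ is irreducible as a Riemannian manifold, even locally: no nonempty open subset of $M$ (in particular not $M$ itself) is isometric to a Riemannian product $(M_1\times M_2,\,g_1\oplus g_2)$ of two Riemannian manifolds of positive dimension. -/

import Mathlib

open Bundle VectorField Manifold
open scoped ContDiff Topology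

noncomputable section

set_option linter.unusedSectionVars false
section General
variable {E : Type*} [NormedAddCommGroup E] [NormedSpace ℝ E] [FiniteDimensional ℝ E]
  {H : Type*} [TopologicalSpace H] {I : ModelWithCorners ℝ E H}
  {M : Type*} [TopologicalSpace M] [ChartedSpace H M] [IsManifold I ∞ M]

namespace LeviCivita

variable (g : ContMDiffRiemannianMetric I ∞ E (fun x : M ↦ TangentSpace I x))

/-- The function `g(X, Y)`. -/
def pairing (X Y : Π x : M, TangentSpace I x) (x : M) : ℝ := g.inner x (X x) (Y x)

/-- Six-term Koszul expression, i.e. `2 g(∇_X Y, Z)` for the Levi-Civita connection `∇`. -/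
def koszul (X Y Z : Π x : M, TangentSpace I x) (x : M) : ℝ :=
  mvfderiv I (pairing g Y Z) x (X x) + mvfderiv I (pairing g X Z) x (Y x)
    - mvfderiv I (pairing g X Y) x (Z x)
    + g.inner x (mlieBracket I X Y x) (Z x) - g.inner x (mlieBracket I X Z x) (Y x)
    - g.inner x (mlieBracket I Y Z x) (X x)

variable {g} in
lemma mdiff_pairing {X Y : Π x : M, TangentSpace I x} {x : M}
    (hX : MDiffAt (T% X) x) (hY : MDiffAt (T% Y) x) : MDiffAt (pairing g X Y) x := by
  have hg := g.contMDiff.mdifferentiableAt (x := x) (by simp)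
  have : MDifferentiableAt I (I.prod 𝓘(ℝ))
      (fun m ↦ TotalSpace.mk' ℝ (E := Bundle.Trivial M ℝ) m (g.inner m (X m) (Y m))) x := by
    apply MDifferentiableAt.clm_bundle_apply₂ (F₁ := E) (F₂ := E)
    · exact hg
    · exact hX
    · exact hY
  rw [mdifferentiableAt_totalSpace] at this
  exact this.2

lemma pairing_comm (X Y : Π x : M, TangentSpace I x) : pairing g X Y = pairing g Y X :=
  funext fun _ ↦ g.symm _ _ _

lemma pairing_smul_left (f : M → ℝ) (X Y : Π x : M, TangentSpace I x) :
    pairing g (f • X) Y = f * pairing g X Y := by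
  ext x; simp [pairing]

lemma pairing_smul_right (f : M → ℝ) (X Y : Π x : M, TangentSpace I x) :
    pairing g X (f • Y) = f * pairing g X Y := by
  ext x; simp [pairing]

lemma pairing_add_left (X X' Y : Π x : M, TangentSpace I x) :
    pairing g (X + X') Y = pairing g X Y + pairing g X' Y := by
  ext x; simp [pairing]

lemma pairing_add_right (X Y Y' : Π x : M, TangentSpace I x) :
    pairing g X (Y + Y') = pairing g X Y + pairing g X Y' := by
  ext x; simp [pairing]

lemma koszul_tensorial_left (x : M) {Y Z : Π x : M, TangentSpace I x}
    (hY : MDiffAt (T% Y) x) (hZ : MDiffAt (T% Z) x) :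
    TensorialAt I E (fun X ↦ koszul g X Y Z x) x where
  smul {f X} hf hX := by
    simp only [koszul, pairing_smul_left, mvfderiv_mul hf (mdiff_pairing hX hZ),
      mvfderiv_mul hf (mdiff_pairing hX hY), mlieBracket_smul_left hf hX]
    simp [pairing]
    ring
  add {X X'} hX hX' := by
    simp only [koszul, pairing_add_left, mvfderiv_add (mdiff_pairing hX hZ) (mdiff_pairing hX' hZ),
      mvfderiv_add (mdiff_pairing hX hY) (mdiff_pairing hX' hY), mlieBracket_add_left hX hX']
    simp
    ring

lemma koszul_tensorial_right (x : M) {X Y : Π x : M, TangentSpace I x}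
    (hX : MDiffAt (T% X) x) (hY : MDiffAt (T% Y) x) :
    TensorialAt I E (fun Z ↦ koszul g X Y Z x) x where
  smul {f Z} hf hZ := by
    simp only [koszul, pairing_smul_right, mvfderiv_mul hf (mdiff_pairing hX hZ),
      mvfderiv_mul hf (mdiff_pairing hY hZ), mlieBracket_smul_right hf hZ]
    simp [pairing]
    rw [g.symm x (Y x) (Z x), g.symm x (X x) (Z x)]
    ring
  add {Z Z'} hZ hZ' := by
    simp only [koszul, pairing_add_right, mvfderiv_add (mdiff_pairing hX hZ) (mdiff_pairing hX hZ'),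
      mvfderiv_add (mdiff_pairing hY hZ) (mdiff_pairing hY hZ'), mlieBracket_add_right hZ hZ']
    simp
    ring

lemma koszul_add_middle {x : M} {X Y Y' Z : Π x : M, TangentSpace I x}
    (hX : MDiffAt (T% X) x) (hY : MDiffAt (T% Y) x) (hY' : MDiffAt (T% Y') x)
    (hZ : MDiffAt (T% Z) x) :
    koszul g X (Y + Y') Z x = koszul g X Y Z x + koszul g X Y' Z x := by
  simp only [koszul, pairing_add_left, pairing_add_right,
    mvfderiv_add (mdiff_pairing hY hZ) (mdiff_pairing hY' hZ),
    mvfderiv_add (mdiff_pairing hX hY) (mdiff_pairing hX hY'),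
    mlieBracket_add_left hY hY', mlieBracket_add_right hY hY']
  simp
  ring

lemma koszul_smul_middle {x : M} {X Y Z : Π x : M, TangentSpace I x} {f : M → ℝ}
    (hf : MDiffAt f x) (hX : MDiffAt (T% X) x) (hY : MDiffAt (T% Y) x) (hZ : MDiffAt (T% Z) x) :
    koszul g X (f • Y) Z x
      = f x * koszul g X Y Z x + 2 * (mvfderiv I f x (X x) * g.inner x (Y x) (Z x)) := by
  simp only [koszul, pairing_smul_left, pairing_smul_right,
    mvfderiv_mul hf (mdiff_pairing hY hZ), mvfderiv_mul hf (mdiff_pairing hX hY),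
    mlieBracket_smul_left hf hY, mlieBracket_smul_right hf hY]
  simp [pairing]
  rw [g.symm x (Y x) (X x)]
  ring

instance finiteDimensional_tangentSpace (x : M) :
    FiniteDimensional ℝ (TangentSpace I x) := inferInstanceAs (FiniteDimensional ℝ E)
instance t2Space_tangentSpace (x : M) : T2Space (TangentSpace I x) := inferInstanceAs (T2Space E)

/-- The musical isomorphism `v ↦ g(v, ·)`. -/
def flat (x : M) : TangentSpace I x ≃ₗ[ℝ] (TangentSpace I x →L[ℝ] ℝ) :=
  LinearMap.linearEquivOfInjective (g.inner x : TangentSpace I x →ₗ[ℝ] _)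
    (by
      rw [injective_iff_map_eq_zero]
      intro v hv
      by_contra h
      exact (g.pos x v h).ne' (by simpa using congr($hv v)))
    (by
      rw [(LinearMap.toContinuousLinearMap (𝕜 := ℝ) (E := TangentSpace I x)
        (F' := ℝ)).symm.finrank_eq]
      exact Subspace.dual_finrank_eq.symm)

lemma flat_apply (x : M) (v w : TangentSpace I x) : flat g x v w = g.inner x v w := rfl

lemma inner_flat_symm (x : M) (α : TangentSpace I x →L[ℝ] ℝ) (w : TangentSpace I x) :
    g.inner x ((flat g x).symm α) w = α w := by
  rw [← flat_apply, LinearEquiv.apply_symm_apply]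

lemma inner_ext {x : M} {v w : TangentSpace I x} (h : ∀ z, g.inner x v z = g.inner x w z) :
    v = w :=
  (flat g x).injective (ContinuousLinearMap.ext h)

open Classical in
/-- The map `v ↦ ∇_v Y` at `x`, obtained from the Koszul formula; it is set to be zero where `Y` is
not differentiable. -/
def nabla (Y : Π x : M, TangentSpace I x) (x : M) : TangentSpace I x →L[ℝ] TangentSpace I x :=
  if hY : MDiffAt (T% Y) x then
    ((2⁻¹ : ℝ) • (flat g x).symm.toLinearMap.toContinuousLinearMap) ∘L
      TensorialAt.mkHom₂ (I := I) (F := E) (F' := E) (fun X Z ↦ koszul g X Y Z x) x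
        (fun _ hZ ↦ koszul_tensorial_left g x hY hZ)
        (fun _ hX ↦ koszul_tensorial_right g x hX hY)
  else 0

/-- The Koszul formula. -/
lemma two_mul_inner_nabla {x : M} {X Y Z : Π x : M, TangentSpace I x}
    (hX : MDiffAt (T% X) x) (hY : MDiffAt (T% Y) x) (hZ : MDiffAt (T% Z) x) :
    2 * g.inner x (nabla g Y x (X x)) (Z x) = koszul g X Y Z x := by
  have := TensorialAt.mkHom₂_apply (I := I) (F := E) (F' := E)
    (Φ := fun X Z ↦ koszul g X Y Z x) (x := x)
    (fun _ hZ ↦ koszul_tensorial_left g x hY hZ)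
    (fun _ hX ↦ koszul_tensorial_right g x hX hY) hX hZ
  simp [nabla, hY, inner_flat_symm, this]

lemma nabla_ext {x : M} {A B : TangentSpace I x →L[ℝ] TangentSpace I x}
    (h : ∀ X Z : Π x : M, TangentSpace I x, MDiffAt (T% X) x → MDiffAt (T% Z) x →
      2 * g.inner x (A (X x)) (Z x) = 2 * g.inner x (B (X x)) (Z x)) : A = B := by
  ext v
  refine inner_ext g fun z ↦ ?_
  have := h (FiberBundle.extend E v) (FiberBundle.extend E z)
    (FiberBundle.mdifferentiableAt_extend ..) (FiberBundle.mdifferentiableAt_extend ..)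
  simpa using this

end LeviCivita

open LeviCivita in
/-- The Levi-Civita connection of a Riemannian metric. -/
def leviCivita (g : ContMDiffRiemannianMetric I ∞ E (fun x : M ↦ TangentSpace I x)) :
    CovariantDerivative I E (fun x : M ↦ TangentSpace I x) where
  toFun := nabla g
  isCovariantDerivativeOnUniv :=
    { add := fun {Y Y' x} hY hY' _ ↦ nabla_ext g fun X Z hX hZ ↦ by
        have hs : MDiffAt (T% (Y + Y')) x := mdifferentiableAt_add_section hY hY'
        rw [two_mul_inner_nabla g hX hs hZ, koszul_add_middle g hX hY hY' hZ,
          ← two_mul_inner_nabla g hX hY hZ, ← two_mul_inner_nabla g hX hY' hZ]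
        simp
        ring
      leibniz := fun {Y f x} hY hf _ ↦ nabla_ext g fun X Z hX hZ ↦ by
        have hs : MDiffAt (T% (f • Y)) x := hf.smul_section hY
        rw [two_mul_inner_nabla g hX hs hZ, koszul_smul_middle g hf hX hY hZ,
          ← two_mul_inner_nabla g hX hY hZ]
        simp
        ring }


section
variable (g : ContMDiffRiemannianMetric I ∞ E (fun x : M ↦ TangentSpace I x))
open LeviCivita

/-- The Levi-Civita connection is torsion-free. -/
theorem leviCivita_torsion : (leviCivita g).torsion = 0 := by
  rw [CovariantDerivative.torsion_eq_zero_iff]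
  intro X Y x hX hY
  refine inner_ext g fun z ↦ ?_
  have hZ : MDiffAt (T% (FiberBundle.extend E z)) x :=
    FiberBundle.mdifferentiableAt_extend ..
  have h1 := two_mul_inner_nabla g hX hY hZ
  have h2 := two_mul_inner_nabla g hY hX hZ
  simp only [koszul, pairing_comm g Y X, mlieBracket_swap_apply (V := Y) (W := X),
    FiberBundle.extend_apply_self] at h1 h2
  simp [leviCivita] at h1 h2 ⊢
  linarith

/-- The Levi-Civita connection is compatible with the metric. -/
theorem leviCivita_metric {x : M} {X Y Z : Π x : M, TangentSpace I x}
    (hX : MDiffAt (T% X) x) (hY : MDiffAt (T% Y) x) (hZ : MDiffAt (T% Z) x) :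
    mvfderiv I (pairing g Y Z) x (X x)
      = g.inner x (leviCivita g Y x (X x)) (Z x) + g.inner x (Y x) (leviCivita g Z x (X x)) := by
  have h1 := two_mul_inner_nabla g hX hY hZ
  have h2 := two_mul_inner_nabla g hX hZ hY
  rw [g.symm x (Y x)]
  simp only [koszul, pairing_comm g Z Y, mlieBracket_swap_apply (V := Z) (W := Y)] at h1 h2
  simp [leviCivita] at h1 h2 ⊢
  linarith

end

section Curvature

/-- `X` is a smooth vector field. -/
def IsSmoothField (X : Π x : M, TangentSpace I x) : Prop :=
  ContMDiff I I.tangent ∞ (fun x ↦ (⟨x, X x⟩ : TangentBundle I M))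

/-- The curvature `R_{XY} Z = ∇_X ∇_Y Z - ∇_Y ∇_X Z - ∇_{[X,Y]} Z` of an affine connection. -/
def curvature (cov : CovariantDerivative I E (fun x : M ↦ TangentSpace I x))
    (X Y Z : Π x : M, TangentSpace I x) (x : M) : TangentSpace I x :=
  cov (fun y ↦ cov Z y (Y y)) x (X x) - cov (fun y ↦ cov Z y (X y)) x (Y x)
    - cov Z x (mlieBracket I X Y x)

/-- The exterior derivative of a 1-form, evaluated on two vector fields, normalized by
`2 dη(X, Y) = X η(Y) - Y η(X) - η([X, Y])`. -/
def extDerivOneForm (η : Π x : M, TangentSpace I x →L[ℝ] ℝ) (X Y : Π x : M, TangentSpace I x)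
    (x : M) : ℝ :=
  (1 / 2) * (mvfderiv I (fun y ↦ η y (Y y)) x (X x) - mvfderiv I (fun y ↦ η y (X y)) x (Y x)
    - η x (mlieBracket I X Y x))

/-- The exterior derivative of a 2-form, evaluated on three vector fields, normalized by
`3 dΩ(X, Y, Z) = X Ω(Y, Z) + Y Ω(Z, X) + Z Ω(X, Y) - Ω([X, Y], Z) - Ω([Y, Z], X) - Ω([Z, X], Y)`. -/
def extDerivTwoForm (Ω : Π x : M, TangentSpace I x → TangentSpace I x → ℝ)
    (X Y Z : Π x : M, TangentSpace I x) (x : M) : ℝ :=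
  (1 / 3) * (mvfderiv I (fun y ↦ Ω y (Y y) (Z y)) x (X x)
    + mvfderiv I (fun y ↦ Ω y (Z y) (X y)) x (Y x)
    + mvfderiv I (fun y ↦ Ω y (X y) (Y y)) x (Z x)
    - Ω x (mlieBracket I X Y x) (Z x) - Ω x (mlieBracket I Y Z x) (X x)
    - Ω x (mlieBracket I Z X x) (Y x))

/-- `η` is a contact form on a manifold of dimension `2n + 1`: the form `η ∧ (dη)ⁿ` vanishes at no
point. Up to a nonzero constant, the alternating sum is the value of `η ∧ (dη)ⁿ` at `x` on the
vector fields `V 0, …, V (2n)`. -/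
def IsContactForm (n : ℕ) (η : Π x : M, TangentSpace I x →L[ℝ] ℝ) : Prop :=
  ∀ x : M, ∃ V : Fin (2 * n + 1) → Π x : M, TangentSpace I x,
    (∀ i, IsSmoothField (V i)) ∧
    ∑ σ : Equiv.Perm (Fin (2 * n + 1)), ((Equiv.Perm.sign σ : ℤ) : ℝ) *
      (η x (V (σ 0) x) *
        ∏ i : Fin n, extDerivOneForm η (V (σ ⟨2 * i + 1, by omega⟩))
          (V (σ ⟨2 * i + 2, by omega⟩)) x) ≠ 0

variable (I M) in
/-- An almost contact metric structure `(φ, ξ, η, g)`: a smooth `(1,1)`-tensor field, a smooth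
vector field, a smooth 1-form and a smooth Riemannian metric with `φ² X = -X + η(X) ξ`,
`η(ξ) = 1` and `g(φX, φY) = g(X, Y) - η(X) η(Y)`. -/
structure AlmostContactMetricStructure where
  φ : Π x : M, TangentSpace I x →L[ℝ] TangentSpace I x
  ξ : Π x : M, TangentSpace I x
  η : Π x : M, TangentSpace I x →L[ℝ] ℝ
  g : ContMDiffRiemannianMetric I ∞ E (fun x : M ↦ TangentSpace I x)
  smooth_φ : ContMDiff I (I.prod 𝓘(ℝ, E →L[ℝ] E)) ∞
    (fun x ↦ TotalSpace.mk' (E →L[ℝ] E) (E := fun x : M ↦ TangentSpace I x →L[ℝ] TangentSpace I x)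
      x (φ x))
  smooth_ξ : IsSmoothField ξ
  smooth_η : ContMDiff I (I.prod 𝓘(ℝ, E →L[ℝ] ℝ)) ∞
    (fun x ↦ TotalSpace.mk' (E →L[ℝ] ℝ) (E := fun x : M ↦ TangentSpace I x →L[ℝ] ℝ) x (η x))
  φ_sq : ∀ (x : M) (v : TangentSpace I x), φ x (φ x v) = -v + η x v • ξ x
  η_ξ : ∀ x : M, η x (ξ x) = 1
  g_φ_φ : ∀ (x : M) (v w : TangentSpace I x),
    g.inner x (φ x v) (φ x w) = g.inner x v w - η x v * η x w

namespace AlmostContactMetricStructure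

variable (A : AlmostContactMetricStructure I M)

/-- The fundamental form `Φ(X, Y) = g(X, φY)`. -/
def fundamentalForm (x : M) (v w : TangentSpace I x) : ℝ := A.g.inner x v (A.φ x w)

/-- The Nijenhuis torsion `N_φ(X, Y) = φ²[X, Y] + [φX, φY] - φ[φX, Y] - φ[X, φY]`. -/
def nijenhuis (X Y : Π x : M, TangentSpace I x) (x : M) : TangentSpace I x :=
  A.φ x (A.φ x (mlieBracket I X Y x))
    + mlieBracket I (fun y ↦ A.φ y (X y)) (fun y ↦ A.φ y (Y y)) x
    - A.φ x (mlieBracket I (fun y ↦ A.φ y (X y)) Y x)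
    - A.φ x (mlieBracket I X (fun y ↦ A.φ y (Y y)) x)

/-- The tensor `N⁽¹⁾ = N_φ + 2 dη ⊗ ξ`. -/
def N1 (X Y : Π x : M, TangentSpace I x) (x : M) : TangentSpace I x :=
  A.nijenhuis X Y x + (2 * extDerivOneForm A.η X Y x) • A.ξ x

/-- Anti-quasi-Sasakian structures: `N⁽¹⁾ = 4 dη ⊗ ξ` and `dΦ = 0`. -/
structure IsAntiQuasiSasakian : Prop where
  N1_eq : ∀ X Y : Π x : M, TangentSpace I x, IsSmoothField X → IsSmoothField Y →
    ∀ x, A.N1 X Y x = (4 * extDerivOneForm A.η X Y x) • A.ξ x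
  closed : ∀ X Y Z : Π x : M, TangentSpace I x, IsSmoothField X → IsSmoothField Y →
    IsSmoothField Z → ∀ x, extDerivTwoForm A.fundamentalForm X Y Z x = 0

/-- The tensor field `S_ξ = -∇ξ`, with `∇` the Levi-Civita connection. -/
def S (x : M) : TangentSpace I x →L[ℝ] TangentSpace I x := -(leviCivita A.g A.ξ x)

/-- The Jacobi operator `J_ξ X = R_{Xξ} ξ` of the Levi-Civita connection. -/
def jacobi (X : Π x : M, TangentSpace I x) : Π x : M, TangentSpace I x :=
  curvature (leviCivita A.g) X A.ξ A.ξ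

/-- The rank of `J_ξ` at `x`: the dimension of the space of the vectors `(J_ξ X)(x)`. -/
def jacobiRank (x : M) : ℕ :=
  Module.finrank ℝ (Submodule.span ℝ {w : TangentSpace I x | ∃ X, IsSmoothField X ∧ A.jacobi X x = w})

end AlmostContactMetricStructure

end Curvature

end General

section Products

universe u

variable {m : ℕ} {M : Type u} [TopologicalSpace M] [ChartedSpace (EuclideanSpace ℝ (Fin m)) M]
  [IsManifold (𝓡 m) ∞ M]

/-- `F` is an isometry of the Riemannian product `(M₁ × M₂, g₁ ⊕ g₂)` onto an open subset
of `(M, g)`. -/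
structure IsProductIsometry {p q : ℕ} {M₁ M₂ : Type*}
    [TopologicalSpace M₁] [ChartedSpace (EuclideanSpace ℝ (Fin p)) M₁] [IsManifold (𝓡 p) ∞ M₁]
    [TopologicalSpace M₂] [ChartedSpace (EuclideanSpace ℝ (Fin q)) M₂] [IsManifold (𝓡 q) ∞ M₂]
    (g₁ : ContMDiffRiemannianMetric (𝓡 p) ∞ (EuclideanSpace ℝ (Fin p))
      (fun x : M₁ ↦ TangentSpace (𝓡 p) x))
    (g₂ : ContMDiffRiemannianMetric (𝓡 q) ∞ (EuclideanSpace ℝ (Fin q))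
      (fun x : M₂ ↦ TangentSpace (𝓡 q) x))
    (g : ContMDiffRiemannianMetric (𝓡 m) ∞ (EuclideanSpace ℝ (Fin m))
      (fun x : M ↦ TangentSpace (𝓡 m) x))
    (F : M₁ × M₂ → M) : Prop where
  dim_eq : p + q = m
  smooth : ContMDiff ((𝓡 p).prod (𝓡 q)) (𝓡 m) ∞ F
  isOpenEmbedding : Topology.IsOpenEmbedding F
  isometric : ∀ (a : M₁) (b : M₂) (v₁ w₁ : TangentSpace (𝓡 p) a) (v₂ w₂ : TangentSpace (𝓡 q) b),
    g.inner (F (a, b)) (mfderiv ((𝓡 p).prod (𝓡 q)) (𝓡 m) F (a, b) (v₁, v₂))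
        (mfderiv ((𝓡 p).prod (𝓡 q)) (𝓡 m) F (a, b) (w₁, w₂))
      = g₁.inner a v₁ w₁ + g₂.inner b v₂ w₂

/-- `(M, g)` is irreducible, even locally: no nonempty open subset of `M` (in particular
not `M` itself) is isometric to a Riemannian product of two manifolds of positive dimension.
It is no restriction that the factors live in the universe of `M`, since they embed in `M`. -/
def IsLocallyIrreducible (g : ContMDiffRiemannianMetric (𝓡 m) ∞ (EuclideanSpace ℝ (Fin m))
    (fun x : M ↦ TangentSpace (𝓡 m) x)) : Prop :=
  ∀ (p q : ℕ) (M₁ M₂ : Type u)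
    [TopologicalSpace M₁] [ChartedSpace (EuclideanSpace ℝ (Fin p)) M₁] [IsManifold (𝓡 p) ∞ M₁]
    [TopologicalSpace M₂] [ChartedSpace (EuclideanSpace ℝ (Fin q)) M₂] [IsManifold (𝓡 q) ∞ M₂]
    [Nonempty M₁] [Nonempty M₂]
    (g₁ : ContMDiffRiemannianMetric (𝓡 p) ∞ (EuclideanSpace ℝ (Fin p))
      (fun x : M₁ ↦ TangentSpace (𝓡 p) x))
    (g₂ : ContMDiffRiemannianMetric (𝓡 q) ∞ (EuclideanSpace ℝ (Fin q))
      (fun x : M₂ ↦ TangentSpace (𝓡 q) x))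
    (F : M₁ × M₂ → M), 1 ≤ p → 1 ≤ q → ¬ IsProductIsometry g₁ g₂ g F

end Products

end

set_option linter.unusedSectionVars false

/-! ### Smooth vector fields: extension from a point, smoothness criteria -/

section SmoothFields

variable {E : Type*} [NormedAddCommGroup E] [NormedSpace ℝ E] [FiniteDimensional ℝ E]
  {H : Type*} [TopologicalSpace H] {I : ModelWithCorners ℝ E H}
  {M : Type*} [TopologicalSpace M] [ChartedSpace H M] [IsManifold I ∞ M]

/-! Setting Y = ξ in the equation for N⁽¹⁾ gives L_ξ η = 0 and L_ξ φ = 0, and dΦ = 0 then gives L_ξ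
Φ = 0. Since g is recovered from η, φ and Φ, the field ξ is Killing (`killing`). Koszul's formula
now reads g(SX, Z) = -dη(X, Z) (`inner_S`), so S is skew, Sξ = 0, and L_ξ S = 0 because L_ξ kills
both g and dη. Expanding R_{Xξ}ξ with torsion-freeness leaves J_ξ = -S² (`jacobi_eq`), which is
g-symmetric and non-negative since g(J_ξ X, Z) = g(SX, SZ).

For the ranks, ξ lies in ker S, and ker S² = ker S by skewness. The kernel of S is the radical of
dη, and linear algebra (`exists_wedge_ne_zero_iff`) shows that η ∧ (dη)ⁿ ≠ 0 exactly when this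
radical is ℝξ.

Irreducibility is proved without curvature. In product coordinates let P be the projection onto one
factor and f = h(ξ, Pξ) = |Pξ|². The Killing equation and the splitting of the metric give 2 dη(Pξ,
·) = -df and [Pξ, ξ] = -½ grad f. Both ξ and Pξ annihilate f, hence so does their bracket; thus
|[Pξ, ξ]|² = 0 and df = 0. So Pξ lies in the radical ℝξ of dη, and ξ is tangent to one factor
(`proj_eq_zero_or`). Every vector of the other factor is then also in the radical, which is
impossible if that factor has positive dimension (`false_of_proj_eq`). -/

lemma isManifold_minSmoothness {n : ℕ} : IsManifold I (minSmoothness ℝ n) M :=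
  .of_le (n := ∞) (by simpa using WithTop.coe_le_coe.2 (le_top : (n : ℕ∞) ≤ ⊤))

namespace IsSmoothField

variable {X Y : Π x : M, TangentSpace I x}

lemma mdiffAt (hX : IsSmoothField X) (x : M) : MDiffAt (T% X) x :=
  (hX x).mdifferentiableAt (by simp)

lemma smul {f : M → ℝ} (hf : ContMDiff I 𝓘(ℝ) ∞ f) (hX : IsSmoothField X) :
    IsSmoothField (f • X) :=
  ContMDiff.smul_section hf hX

lemma neg (hX : IsSmoothField X) : IsSmoothField (-X) :=
  ContMDiff.neg_section hX

lemma mlieBracket (hX : IsSmoothField X) (hY : IsSmoothField Y) :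
    IsSmoothField (mlieBracket I X Y) :=
  have : IsManifold I (minSmoothness ℝ 2) M := isManifold_minSmoothness
  have : IsManifold I ((⊤ : ℕ∞) + 1) M := inferInstanceAs (IsManifold I ∞ M)
  ContDiff.mlieBracket_vectorField (m := ⊤) (n := ⊤) hX hY (by simp)

lemma jacobi {Z : Π x : M, TangentSpace I x} (hX : IsSmoothField X) (hY : IsSmoothField Y)
    (hZ : IsSmoothField Z) (x : M) :
    VectorField.mlieBracket I X (VectorField.mlieBracket I Y Z) x =
      VectorField.mlieBracket I (VectorField.mlieBracket I X Y) Z x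
        + VectorField.mlieBracket I Y (VectorField.mlieBracket I X Z) x := by
  have : IsManifold I (minSmoothness ℝ 3) M := isManifold_minSmoothness
  have h2 : minSmoothness ℝ 2 ≤ ∞ := by
    simpa using WithTop.coe_le_coe.2 (le_top : (2 : ℕ∞) ≤ ⊤)
  exact leibniz_identity_mlieBracket_apply ((hX x).of_le h2) ((hY x).of_le h2) ((hZ x).of_le h2)

end IsSmoothField

lemma contMDiff_pairing (g : ContMDiffRiemannianMetric I ∞ E (fun x : M ↦ TangentSpace I x))
    {X Y : Π x : M, TangentSpace I x} (hX : IsSmoothField X) (hY : IsSmoothField Y) :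
    ContMDiff I 𝓘(ℝ) ∞ (LeviCivita.pairing g X Y) := by
  intro x
  have : ContMDiffAt I (I.prod 𝓘(ℝ)) ∞
      (fun m ↦ TotalSpace.mk' ℝ (E := Bundle.Trivial M ℝ) m (g.inner m (X m) (Y m))) x :=
    ContMDiffAt.clm_bundle_apply₂ (F₁ := E) (F₂ := E) (g.contMDiff x) (hX x) (hY x)
  rw [contMDiffAt_totalSpace] at this
  exact this.2

/-- Every tangent vector extends to a smooth vector field. -/
lemma exists_isSmoothField [T2Space M] (x : M) (v : TangentSpace I x) :
    ∃ X : Π x : M, TangentSpace I x, IsSmoothField X ∧ X x = v := by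
  obtain ⟨s, hs, hsm⟩ := FiberBundle.exists_contMDiffOn_extend (k := ∞) I E v
  -- The local extension is smooth only near x, so it is cut off by a bump function equal to 1 at x.
  obtain ⟨f, -, hf⟩ := (SmoothBumpFunction.nhds_basis_tsupport (I := I) x).mem_iff.1
    (interior_mem_nhds.2 hs)
  refine ⟨(f : M → ℝ) • FiberBundle.extend E v,
    ContMDiffOn.smul_section_of_tsupport f.contMDiff.contMDiffOn isOpen_interior hf
      (hsm.mono interior_subset), ?_⟩
  simp

lemma contMDiffAt_det {ι : Type*} [Fintype ι] [DecidableEq ι] {A : M → Matrix ι ι ℝ} {x : M}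
    (hA : ∀ i j, ContMDiffAt I 𝓘(ℝ) ∞ (fun y ↦ A y i j) x) :
    ContMDiffAt I 𝓘(ℝ) ∞ (fun y ↦ (A y).det) x := by
  simp only [Matrix.det_apply']
  refine contMDiffAt_finsetSum fun σ _ ↦ ?_
  exact contMDiffAt_const.mul (contMDiffAt_finsetProd fun i _ ↦ hA _ _)

lemma contMDiffAt_matrix_inv {ι : Type*} [Fintype ι] [DecidableEq ι] {A : M → Matrix ι ι ℝ} {x : M}
    (hA : ∀ i j, ContMDiffAt I 𝓘(ℝ) ∞ (fun y ↦ A y i j) x) (hx : (A x).det ≠ 0) (i j : ι) :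
    ContMDiffAt I 𝓘(ℝ) ∞ (fun y ↦ (A y)⁻¹ i j) x := by
  simp only [Matrix.inv_def, Ring.inverse_eq_inv', Matrix.smul_apply, smul_eq_mul,
    Matrix.adjugate_apply]
  refine ((contMDiffAt_det hA).inv₀ hx).mul (contMDiffAt_det fun k l ↦ ?_)
  by_cases hk : k = j
  · subst hk
    simp only [Matrix.updateRow_self]
    exact contMDiffAt_const
  · simp only [Matrix.updateRow_ne hk]
    exact hA k l

/-- A vector field is smooth once its inner products with smooth vector fields are. -/
lemma isSmoothField_of_pairing [T2Space M]
    (g : ContMDiffRiemannianMetric I ∞ E (fun x : M ↦ TangentSpace I x))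
    {Y : Π x : M, TangentSpace I x}
    (h : ∀ Z, IsSmoothField Z → ContMDiff I 𝓘(ℝ) ∞ (LeviCivita.pairing g Y Z)) :
    IsSmoothField Y := by
  intro x
  let b := Module.finBasis ℝ (TangentSpace I x)
  choose e he hex using fun i ↦ exists_isSmoothField (I := I) x (b i)
  -- Gram matrix of a frame near x. The coefficients of Y in the frame are the inverse of G applied
  -- to the inner products of Y with the frame, hence smooth where det G ≠ 0.
  let G : M → Matrix _ _ ℝ := fun y ↦ .of fun i j ↦ g.inner y (e i y) (e j y)
  have hG : ∀ i j, ContMDiff I 𝓘(ℝ) ∞ (fun y ↦ G y i j) := fun i j ↦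
    contMDiff_pairing g (he i) (he j)
  have hGx : (G x).det ≠ 0 := by
    intro h0
    obtain ⟨v, hv, hGv⟩ := Matrix.exists_mulVec_eq_zero_iff.2 h0
    have hz : ∑ j, v j • b j = 0 := by
      apply (LeviCivita.flat g x).injective
      rw [map_zero]
      ext w
      have : ∀ i, g.inner x (∑ j, v j • b j) (b i) = 0 := fun i ↦ by
        have := congrFun hGv i
        simp only [Matrix.mulVec, dotProduct, G, Matrix.of_apply, hex] at this
        simpa [mul_comm, g.symm x _ (b i)] using this
      rw [LeviCivita.flat_apply, ← b.sum_repr w]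
      rw [map_sum]
      exact Finset.sum_eq_zero fun i _ ↦ by rw [map_smul, this, smul_zero]
    exact hv (funext fun i ↦ Fintype.linearIndependent_iff.1 b.linearIndependent v hz i)
  have hev : ∀ᶠ y in 𝓝 x, (G y).det ≠ 0 :=
    (contMDiffAt_det fun i j ↦ (hG i j x)).continuousAt.eventually_ne hGx
  have key : ∀ᶠ y in 𝓝 x,
      Y y = ∑ i, (∑ j, (G y)⁻¹ i j * LeviCivita.pairing g Y (e j) y) • e i y := by
    filter_upwards [hev] with y hy
    have hli : LinearIndependent ℝ (fun i ↦ e i y) := by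
      rw [Fintype.linearIndependent_iff]
      intro v hv
      by_contra! hne
      refine hy (Matrix.exists_mulVec_eq_zero_iff.1
        ⟨v, fun h ↦ by obtain ⟨i, hi⟩ := hne; exact hi (congrFun h i), ?_⟩)
      ext i
      have : g.inner y (e i y) (∑ j, v j • e j y) = 0 := by rw [hv]; simp
      simpa [Matrix.mulVec, dotProduct, G, mul_comm] using this
    have hspan : ⊤ ≤ Submodule.span ℝ (Set.range fun i ↦ e i y) := by
      refine (hli.span_eq_top_of_card_eq_finrank' ?_).ge
      rw [Fintype.card_fin]
      rfl
    let b' := Module.Basis.mk hli hspan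
    apply LeviCivita.inner_ext g
    intro z
    have hj : ∀ k, g.inner y (Y y) (e k y) = g.inner y
        (∑ i, (∑ j, (G y)⁻¹ i j * LeviCivita.pairing g Y (e j) y) • e i y) (e k y) := by
      intro k
      have hmul : Matrix.vecMul ((G y)⁻¹.mulVec fun j ↦ LeviCivita.pairing g Y (e j) y) (G y) k
          = LeviCivita.pairing g Y (e k) y := by
        have hs : (G y).transpose = G y := by
          ext i j; exact g.symm y _ _
        rw [← Matrix.mulVec_transpose, hs, Matrix.mulVec_mulVec,
          Matrix.mul_nonsing_inv _ (isUnit_iff_ne_zero.2 hy), Matrix.one_mulVec]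
      rw [← LeviCivita.pairing, ← hmul]
      simp [Matrix.vecMul, dotProduct, Matrix.mulVec, G]
    rw [← b'.sum_repr z]
    simp only [map_sum, map_smul, b', Module.Basis.mk_apply, hj]
  have hs : ContMDiffAt I I.tangent ∞
      (T% (fun y ↦ ∑ i, (∑ j, (G y)⁻¹ i j * LeviCivita.pairing g Y (e j) y) • e i y)) x := by
    refine ContMDiffAt.sum_section fun i _ ↦ ?_
    refine ContMDiffAt.smul_section (contMDiffAt_finsetSum fun j _ ↦ ?_) (he i x)
    exact (contMDiffAt_matrix_inv (fun i j ↦ hG i j x) hGx i j).mul (h (e j) (he j) x)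
  refine hs.congr_of_eventuallyEq ?_
  filter_upwards [key] with y hy
  rw [hy]

end SmoothFields

/-! ### Identities of almost contact metric structures -/

section AlmostContact

variable {E : Type*} [NormedAddCommGroup E] [NormedSpace ℝ E] [FiniteDimensional ℝ E]
  {H : Type*} [TopologicalSpace H] {I : ModelWithCorners ℝ E H}
  {M : Type*} [TopologicalSpace M] [ChartedSpace H M] [IsManifold I ∞ M]

namespace AlmostContactMetricStructure

open LeviCivita

variable (A : AlmostContactMetricStructure I M)

lemma ξ_ne_zero (x : M) : A.ξ x ≠ 0 := fun h ↦ by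
  have := A.η_ξ x
  simp [h] at this

/-- From φ²ξ = 0, expanding φ³ξ gives φξ = η(φξ) ξ. Applying φ once more yields η(φξ) φξ = 0, and
either factor vanishing suffices. -/
lemma φ_ξ (x : M) : A.φ x (A.ξ x) = 0 := by
  have h1 : A.φ x (A.φ x (A.ξ x)) = 0 := by rw [A.φ_sq, A.η_ξ]; simp
  have h2 := A.φ_sq x (A.φ x (A.ξ x))
  rw [h1, map_zero] at h2
  have h3 : A.φ x (A.ξ x) = A.η x (A.φ x (A.ξ x)) • A.ξ x := (neg_add_eq_zero.1 h2.symm)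
  have h4 : A.η x (A.φ x (A.ξ x)) • A.φ x (A.ξ x) = 0 := by
    rw [← map_smul, ← h3, h1]
  rcases smul_eq_zero.1 h4 with h | h
  · rw [h3, h, zero_smul]
  · exact h

/-- Compare the two expansions of φ³v, as φ²(φv) and as φ(φ²v). -/
lemma η_φ (x : M) (v : TangentSpace I x) : A.η x (A.φ x v) = 0 := by
  have h1 := A.φ_sq x (A.φ x v)
  rw [A.φ_sq x v, map_add, map_neg, map_smul, A.φ_ξ, smul_zero, add_zero] at h1
  have h2 : A.η x (A.φ x v) • A.ξ x = 0 := left_eq_add.1 h1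
  exact (smul_eq_zero.1 h2).resolve_right (A.ξ_ne_zero x)

lemma inner_ξ (x : M) (v : TangentSpace I x) : A.g.inner x v (A.ξ x) = A.η x v := by
  have := A.g_φ_φ x v (A.ξ x)
  rw [A.φ_ξ, map_zero, A.η_ξ] at this
  linarith

lemma ξ_inner (x : M) (v : TangentSpace I x) : A.g.inner x (A.ξ x) v = A.η x v := by
  rw [A.g.symm, A.inner_ξ]

lemma inner_φ_left (x : M) (v w : TangentSpace I x) :
    A.g.inner x (A.φ x v) w = -A.g.inner x v (A.φ x w) := by
  have := A.g_φ_φ x v (A.φ x w)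
  rw [A.φ_sq, A.η_φ, map_add, map_neg, map_smul, A.inner_ξ, A.η_φ] at this
  simp at this
  linarith

lemma isSmoothField_φ {X : Π x : M, TangentSpace I x} (hX : IsSmoothField X) :
    IsSmoothField fun y ↦ A.φ y (X y) :=
  fun x ↦ ContMDiffAt.clm_bundle_apply (F₁ := E) (F₂ := E) (A.smooth_φ x) (hX x)

lemma pairing_ξ (X : Π x : M, TangentSpace I x) : pairing A.g X A.ξ = fun y ↦ A.η y (X y) :=
  funext fun y ↦ A.inner_ξ y (X y)

lemma contMDiff_η {X : Π x : M, TangentSpace I x} (hX : IsSmoothField X) :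
    ContMDiff I 𝓘(ℝ) ∞ fun y ↦ A.η y (X y) := by
  rw [← A.pairing_ξ]
  exact contMDiff_pairing A.g hX A.smooth_ξ

/-- Expresses the derivative X f through brackets of vector fields, so that smoothness of X f and
the commutator formula follow from properties of the bracket, without charts. -/
lemma η_mlieBracket_smul_ξ {f : M → ℝ} (hf : ContMDiff I 𝓘(ℝ) ∞ f) (X : Π x : M, TangentSpace I x)
    (x : M) : A.η x (mlieBracket I X (f • A.ξ) x)
      = mvfderiv I f x (X x) + f x * A.η x (mlieBracket I X A.ξ x) := by
  rw [mlieBracket_smul_right (hf.mdifferentiable (by simp) x) (A.smooth_ξ.mdiffAt x)]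
  simp [A.η_ξ]

/-- The derivative of a smooth function along a smooth vector field is smooth. -/
lemma contMDiff_mvfderiv (A : AlmostContactMetricStructure I M) {f : M → ℝ}
    (hf : ContMDiff I 𝓘(ℝ) ∞ f) {X : Π x : M, TangentSpace I x}
    (hX : IsSmoothField X) : ContMDiff I 𝓘(ℝ) ∞ fun x ↦ mvfderiv I f x (X x) := by
  have h1 := (A.contMDiff_η (hX.mlieBracket (.smul hf A.smooth_ξ))).sub
    (hf.mul (A.contMDiff_η (hX.mlieBracket A.smooth_ξ)))
  convert h1 using 2 with x
  rw [A.η_mlieBracket_smul_ξ hf]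
  simp

/-- The Lie bracket of vector fields acts on functions as the commutator of derivations. -/
lemma mvfderiv_mlieBracket (A : AlmostContactMetricStructure I M) {f : M → ℝ}
    (hf : ContMDiff I 𝓘(ℝ) ∞ f)
    {X Y : Π x : M, TangentSpace I x} (hX : IsSmoothField X) (hY : IsSmoothField Y) (x : M) :
    mvfderiv I f x (mlieBracket I X Y x)
      = mvfderiv I (fun y ↦ mvfderiv I f y (Y y)) x (X x)
        - mvfderiv I (fun y ↦ mvfderiv I f y (X y)) x (Y x) := by
  have key : ∀ {X Y : Π x : M, TangentSpace I x}, IsSmoothField X → IsSmoothField Y →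
      mlieBracket I X (mlieBracket I Y (f • A.ξ)) x
        = mvfderiv I (fun y ↦ mvfderiv I f y (Y y)) x (X x) • A.ξ x
          + mvfderiv I f x (Y x) • mlieBracket I X A.ξ x
          + mvfderiv I f x (X x) • mlieBracket I Y A.ξ x
          + f x • mlieBracket I X (mlieBracket I Y A.ξ) x := by
    intro X Y hX hY
    have h1 : mlieBracket I Y (f • A.ξ)
        = (fun y ↦ mvfderiv I f y (Y y)) • A.ξ + f • mlieBracket I Y A.ξ :=
      funext fun y ↦ mlieBracket_smul_right (hf.mdifferentiable (by simp) y) (A.smooth_ξ.mdiffAt y)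
    have hYf := A.contMDiff_mvfderiv hf hY
    have hYξ := hY.mlieBracket A.smooth_ξ
    rw [h1, mlieBracket_add_right ((IsSmoothField.smul hYf A.smooth_ξ).mdiffAt x)
      ((IsSmoothField.smul hf hYξ).mdiffAt x),
      mlieBracket_smul_right (hYf.mdifferentiable (by simp) x) (A.smooth_ξ.mdiffAt x),
      mlieBracket_smul_right (hf.mdifferentiable (by simp) x) (hYξ.mdiffAt x)]
    abel
  -- The Jacobi identity for X, Y, fξ: once the one for X, Y, ξ is subtracted, the coefficient of ξ,
  -- read off by η, is the commutator formula.
  have h1 := IsSmoothField.jacobi hX hY (.smul hf A.smooth_ξ) x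
  rw [key hX hY, key hY hX, mlieBracket_smul_right (hf.mdifferentiable (by simp) x)
    (A.smooth_ξ.mdiffAt x), IsSmoothField.jacobi hX hY A.smooth_ξ x] at h1
  have h2 := congrArg (A.η x) h1
  simp [A.η_ξ] at h2
  linarith

lemma extDerivOneForm_swap (X Y : Π x : M, TangentSpace I x) (x : M) :
    extDerivOneForm A.η X Y x = -extDerivOneForm A.η Y X x := by
  simp only [extDerivOneForm, mlieBracket_swap_apply (V := X) (W := Y), map_neg]
  ring

lemma contMDiff_extDerivOneForm {X Y : Π x : M, TangentSpace I x} (hX : IsSmoothField X)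
    (hY : IsSmoothField Y) : ContMDiff I 𝓘(ℝ) ∞ (extDerivOneForm A.η X Y) := by
  unfold extDerivOneForm
  exact contMDiff_const.mul (((A.contMDiff_mvfderiv (A.contMDiff_η hY) hX).sub
    (A.contMDiff_mvfderiv (A.contMDiff_η hX) hY)).sub (A.contMDiff_η (hX.mlieBracket hY)))

lemma mvfderiv_η_ξ (x : M) (v : TangentSpace I x) :
    mvfderiv I (fun y ↦ A.η y (A.ξ y)) x v = 0 := by
  have : (fun y ↦ A.η y (A.ξ y)) = fun _ ↦ (1 : ℝ) := funext A.η_ξ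
  rw [this, mvfderiv_const]
  rfl

end AlmostContactMetricStructure

/-! ### Invariance of the structure under the Reeb field -/

namespace AlmostContactMetricStructure.IsAntiQuasiSasakian

open LeviCivita

variable {A : AlmostContactMetricStructure I M} {X Y Z : Π x : M, TangentSpace I x}

/-- The terms containing φξ drop out and the rest lies in the image of φ, on which η vanishes. -/
lemma nijenhuis_ξ (A : AlmostContactMetricStructure I M) (X : Π x : M, TangentSpace I x) (x : M) :
    A.nijenhuis X A.ξ x = A.φ x (A.φ x (mlieBracket I X A.ξ x)
      - mlieBracket I (fun y ↦ A.φ y (X y)) A.ξ x) := by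
  have h : (fun y ↦ A.φ y (A.ξ y)) = 0 := funext A.φ_ξ
  simp [nijenhuis, h]

/-- Applying η to N⁽¹⁾(X, ξ) removes the Nijenhuis part and leaves 2 dη(X, ξ) = 4 dη(X, ξ). -/
lemma extDerivOneForm_ξ_right (hA : A.IsAntiQuasiSasakian) (hX : IsSmoothField X) (x : M) :
    extDerivOneForm A.η X A.ξ x = 0 := by
  have h1 := congrArg (A.η x) (hA.N1_eq X A.ξ hX A.smooth_ξ x)
  simp only [N1, nijenhuis_ξ, map_add, map_smul, A.η_φ, A.η_ξ, smul_eq_mul] at h1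
  linarith

lemma extDerivOneForm_ξ_left (hA : A.IsAntiQuasiSasakian) (hX : IsSmoothField X) (x : M) :
    extDerivOneForm A.η A.ξ X x = 0 := by
  rw [A.extDerivOneForm_swap, hA.extDerivOneForm_ξ_right hX, neg_zero]

/-- The Lie derivative `L_ξ η` vanishes. -/
lemma mvfderiv_η (hA : A.IsAntiQuasiSasakian) (hX : IsSmoothField X) (x : M) :
    mvfderiv I (fun y ↦ A.η y (X y)) x (A.ξ x) = A.η x (mlieBracket I A.ξ X x) := by
  have h1 := hA.extDerivOneForm_ξ_left hX x
  simp only [extDerivOneForm, A.mvfderiv_η_ξ] at h1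
  linarith

/-- The Lie derivative `L_ξ φ` vanishes. -/
lemma mlieBracket_ξ_φ (hA : A.IsAntiQuasiSasakian) (hX : IsSmoothField X) (x : M) :
    mlieBracket I A.ξ (fun y ↦ A.φ y (X y)) x = A.φ x (mlieBracket I A.ξ X x) := by
  have h1 := hA.N1_eq X A.ξ hX A.smooth_ξ x
  simp only [N1, nijenhuis_ξ, hA.extDerivOneForm_ξ_right hX, mul_zero, zero_smul, add_zero] at h1
  -- With u = φ[X, ξ] - [φX, ξ], `h1` says φu = 0, so 0 = φ²u = -u + η(u)ξ. Here η(u) = 0, since L_ξ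
  -- η = 0 applied to φX gives η([ξ, φX]) = 0.
  have h2 := congrArg (A.φ x) h1
  have h3 := hA.mvfderiv_η (A.isSmoothField_φ hX) x
  have h4 : (fun y ↦ A.η y (A.φ y (X y))) = fun _ ↦ (0 : ℝ) := funext fun y ↦ A.η_φ y (X y)
  rw [h4, mvfderiv_const] at h3
  rw [A.φ_sq, mlieBracket_swap_apply (V := X), mlieBracket_swap_apply (W := A.ξ), map_neg,
    neg_sub_neg, map_sub, A.η_φ, ← h3, map_zero] at h2
  simp [sub_eq_zero] at h2
  exact h2.symm

lemma fundamentalForm_ξ_right (x : M) (v : TangentSpace I x) :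
    A.fundamentalForm x v (A.ξ x) = 0 := by
  simp [fundamentalForm, A.φ_ξ]

lemma fundamentalForm_ξ_left (x : M) (v : TangentSpace I x) :
    A.fundamentalForm x (A.ξ x) v = 0 := by
  simp [fundamentalForm, A.ξ_inner, A.η_φ]

lemma fundamentalForm_swap (x : M) (v w : TangentSpace I x) :
    A.fundamentalForm x v w = -A.fundamentalForm x w v := by
  rw [fundamentalForm, fundamentalForm, A.g.symm, A.inner_φ_left]

/-- The Lie derivative `L_ξ Φ` vanishes. -/
lemma mvfderiv_fundamentalForm (hA : A.IsAntiQuasiSasakian) (hX : IsSmoothField X)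
    (hY : IsSmoothField Y) (x : M) :
    mvfderiv I (fun y ↦ A.fundamentalForm y (X y) (Y y)) x (A.ξ x)
      = A.fundamentalForm x (mlieBracket I A.ξ X x) (Y x)
        + A.fundamentalForm x (X x) (mlieBracket I A.ξ Y x) := by
  have h1 := hA.closed A.ξ X Y A.smooth_ξ hX hY x
  simp only [extDerivTwoForm, fundamentalForm_ξ_right, fundamentalForm_ξ_left, mvfderiv_const,
    mlieBracket_swap_apply (V := Y) (W := A.ξ)] at h1
  rw [fundamentalForm_swap x (-_)] at h1
  have h2 : A.fundamentalForm x (X x) (-mlieBracket I A.ξ Y x)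
      = -A.fundamentalForm x (X x) (mlieBracket I A.ξ Y x) := by simp [fundamentalForm]
  rw [h2] at h1
  simp at h1
  linarith

/-- The Reeb field is a Killing field. -/
lemma killing (hA : A.IsAntiQuasiSasakian) (hX : IsSmoothField X) (hY : IsSmoothField Y) (x : M) :
    mvfderiv I (pairing A.g X Y) x (A.ξ x)
      = A.g.inner x (mlieBracket I A.ξ X x) (Y x) + A.g.inner x (X x) (mlieBracket I A.ξ Y x) := by
  -- As g(X, φY) = Φ(X, Y), invariance of Φ and φ gives invariance of g whenever the second argument
  -- is in the image of φ.
  have hφ : ∀ {Y : Π x : M, TangentSpace I x}, IsSmoothField Y →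
      mvfderiv I (pairing A.g X (fun y ↦ A.φ y (Y y))) x (A.ξ x)
        = A.g.inner x (mlieBracket I A.ξ X x) (A.φ x (Y x))
          + A.g.inner x (X x) (mlieBracket I A.ξ (fun y ↦ A.φ y (Y y)) x) := fun hY ↦ by
    rw [hA.mlieBracket_ξ_φ hY]
    exact hA.mvfderiv_fundamentalForm hX hY x
  have hηY := A.contMDiff_η hY
  have hφY := A.isSmoothField_φ (A.isSmoothField_φ hY)
  have hηξ : IsSmoothField ((fun y ↦ A.η y (Y y)) • A.ξ) := .smul hηY A.smooth_ξ
  -- The φ²Y part is covered by `hφ`, and the ξ part by L_ξ η = 0, since g(X, ξ) = η(X).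
  have hdec : Y = -(fun y ↦ A.φ y (A.φ y (Y y))) + (fun y ↦ A.η y (Y y)) • A.ξ := by
    funext y
    simp [A.φ_sq]
  have h1 := hφ (A.isSmoothField_φ hY)
  have h2 : mvfderiv I (pairing A.g X ((fun y ↦ A.η y (Y y)) • A.ξ)) x (A.ξ x)
        = A.g.inner x (mlieBracket I A.ξ X x) (((fun y ↦ A.η y (Y y)) • A.ξ) x)
          + A.g.inner x (X x) (mlieBracket I A.ξ ((fun y ↦ A.η y (Y y)) • A.ξ) x) := by
    rw [pairing_smul_right, A.pairing_ξ, mvfderiv_mul (hηY.mdifferentiable (by simp) x)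
      ((A.contMDiff_η hX).mdifferentiable (by simp) x),
      mlieBracket_smul_right (hηY.mdifferentiable (by simp) x) (A.smooth_ξ.mdiffAt x),
      mlieBracket_self]
    simp [A.inner_ξ, hA.mvfderiv_η hX, mul_comm]
  have h3 : pairing A.g X Y = -pairing A.g X (fun y ↦ A.φ y (A.φ y (Y y)))
      + pairing A.g X ((fun y ↦ A.η y (Y y)) • A.ξ) := by
    funext y
    simp [pairing, A.φ_sq]
  have h4 : mlieBracket I A.ξ Y x = -mlieBracket I A.ξ (fun y ↦ A.φ y (A.φ y (Y y))) x
      + mlieBracket I A.ξ ((fun y ↦ A.η y (Y y)) • A.ξ) x := by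
    conv_lhs => rw [hdec]
    rw [mlieBracket_add_right (hφY.neg.mdiffAt x) (hηξ.mdiffAt x), ← neg_one_smul ℝ (fun y ↦ _),
      mlieBracket_const_smul_right (hφY.mdiffAt x), neg_one_smul]
  have h5 : Y x = -(A.φ x (A.φ x (Y x))) + ((fun y ↦ A.η y (Y y)) • A.ξ) x := congrFun hdec x
  have h6 : MDiffAt (-pairing A.g X (fun y ↦ A.φ y (A.φ y (Y y)))) x :=
    (contMDiff_pairing A.g hX hφY).neg.mdifferentiable (by simp) x
  rw [h3, mvfderiv_add h6
    ((contMDiff_pairing A.g hX hηξ).mdifferentiable (by simp) x), mvfderiv_neg, h4, h5]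
  simp only [add_apply, neg_apply, map_add, map_neg, h1, h2]
  ring

end AlmostContactMetricStructure.IsAntiQuasiSasakian

end AlmostContact

/-! ### The tensor S and the Jacobi operator of ξ -/

section Reeb

variable {E : Type*} [NormedAddCommGroup E] [NormedSpace ℝ E] [FiniteDimensional ℝ E]
  {H : Type*} [TopologicalSpace H] {I : ModelWithCorners ℝ E H}
  {M : Type*} [TopologicalSpace M] [ChartedSpace H M] [IsManifold I ∞ M]

namespace AlmostContactMetricStructure.IsAntiQuasiSasakian

open LeviCivita

variable {A : AlmostContactMetricStructure I M} {X Y Z : Π x : M, TangentSpace I x}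

/-- Koszul's expression for 2 g(∇_X ξ, Z) is 2 dη(X, Z) + (L_ξ g)(X, Z), and the second term
vanishes because ξ is Killing. -/
lemma inner_S (hA : A.IsAntiQuasiSasakian) (hX : IsSmoothField X) (hZ : IsSmoothField Z) (x : M) :
    A.g.inner x (A.S x (X x)) (Z x) = -extDerivOneForm A.η X Z x := by
  have h1 := two_mul_inner_nabla A.g (hX.mdiffAt x) (A.smooth_ξ.mdiffAt x) (hZ.mdiffAt x)
  have h2 := hA.killing hX hZ x
  simp only [koszul, A.pairing_ξ, pairing_comm A.g A.ξ Z, h2, A.inner_ξ,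
    mlieBracket_swap_apply (V := X) (W := A.ξ), map_neg, neg_apply] at h1
  have h3 : A.S x (X x) = -nabla A.g A.ξ x (X x) := rfl
  rw [A.g.symm x (X x)] at h1
  rw [h3, map_neg, neg_apply, extDerivOneForm]
  linarith

lemma S_ξ (hA : A.IsAntiQuasiSasakian) [T2Space M] (x : M) : A.S x (A.ξ x) = 0 := by
  refine inner_ext A.g fun z ↦ ?_
  obtain ⟨Z, hZ, rfl⟩ := exists_isSmoothField x z
  rw [hA.inner_S A.smooth_ξ hZ, hA.extDerivOneForm_ξ_left hZ]
  simp

lemma inner_S_left (hA : A.IsAntiQuasiSasakian) [T2Space M] (x : M) (v w : TangentSpace I x) :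
    A.g.inner x (A.S x v) w = -A.g.inner x v (A.S x w) := by
  obtain ⟨V, hV, rfl⟩ := exists_isSmoothField x v
  obtain ⟨W, hW, rfl⟩ := exists_isSmoothField x w
  rw [A.g.symm x (V x), hA.inner_S hV hW, hA.inner_S hW hV, A.extDerivOneForm_swap]

/-- Needed to bracket and differentiate SX. Smoothness comes from the pairings -dη(X, Z), so nothing
about smoothness of the connection enters. -/
lemma isSmoothField_S (hA : A.IsAntiQuasiSasakian) [T2Space M] (hX : IsSmoothField X) :
    IsSmoothField fun y ↦ A.S y (X y) := by
  refine isSmoothField_of_pairing A.g fun Z hZ ↦ ?_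
  convert (A.contMDiff_extDerivOneForm hX hZ).neg using 1
  exact funext fun y ↦ hA.inner_S hX hZ y

/-- The Lie derivative `L_ξ dη` vanishes. -/
lemma mvfderiv_extDerivOneForm (hA : A.IsAntiQuasiSasakian) (hX : IsSmoothField X)
    (hZ : IsSmoothField Z) (x : M) :
    mvfderiv I (extDerivOneForm A.η X Z) x (A.ξ x)
      = extDerivOneForm A.η (mlieBracket I A.ξ X) Z x
        + extDerivOneForm A.η X (mlieBracket I A.ξ Z) x := by
  have hη : ∀ {Y : Π x : M, TangentSpace I x}, IsSmoothField Y →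
      (fun y ↦ A.η y (mlieBracket I A.ξ Y y))
        = fun y ↦ mvfderiv I (fun y ↦ A.η y (Y y)) y (A.ξ y) :=
    fun hY ↦ funext fun y ↦ (hA.mvfderiv_η hY y).symm
  have h1 := A.contMDiff_mvfderiv (A.contMDiff_η hZ) hX
  have h2 := A.contMDiff_mvfderiv (A.contMDiff_η hX) hZ
  have h3 := A.contMDiff_η (hX.mlieBracket hZ)
  -- L_ξ commutes with d: the first two terms of 2 dη(X, Z) are handled by the commutator formula,
  -- the third by the Jacobi identity, together with ξ η(Y) = η([ξ, Y]).
  have e1 := A.mvfderiv_mlieBracket (A.contMDiff_η hZ) A.smooth_ξ hX x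
  have e2 := A.mvfderiv_mlieBracket (A.contMDiff_η hX) A.smooth_ξ hZ x
  have e3 := congrArg (A.η x) (A.smooth_ξ.jacobi hX hZ x)
  rw [map_add, ← hA.mvfderiv_η (hX.mlieBracket hZ)] at e3
  have e4 : mvfderiv I (extDerivOneForm A.η X Z) x (A.ξ x)
      = (1 / 2) * (mvfderiv I (fun y ↦ mvfderiv I (fun y ↦ A.η y (Z y)) y (X y)) x (A.ξ x)
        - mvfderiv I (fun y ↦ mvfderiv I (fun y ↦ A.η y (X y)) y (Z y)) x (A.ξ x)
        - mvfderiv I (fun y ↦ A.η y (mlieBracket I X Z y)) x (A.ξ x)) := by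
    have hd : ∀ {a b c : M → ℝ}, MDiffAt a x → MDiffAt b x → MDiffAt c x →
        mvfderiv I (fun y ↦ (1 / 2 : ℝ) * (a y - b y - c y)) x (A.ξ x) = (1 / 2) *
          (mvfderiv I a x (A.ξ x) - mvfderiv I b x (A.ξ x) - mvfderiv I c x (A.ξ x)) := by
      intro a b c ha hb hc
      have h : MDiffAt (fun _ : M ↦ (1 / 2 : ℝ)) x := mdifferentiableAt_const
      have := mvfderiv_mul h ((ha.sub hb).sub hc)
      rw [mvfderiv_sub (ha.sub hb) hc, mvfderiv_sub ha hb, mvfderiv_const] at this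
      simpa using! congrArg (· (A.ξ x)) this
    exact hd (h1.mdifferentiable (by simp) x) (h2.mdifferentiable (by simp) x)
      (h3.mdifferentiable (by simp) x)
  rw [e4]
  simp only [extDerivOneForm, hη hX, hη hZ]
  linarith

/-- The Lie derivative `L_ξ S` vanishes. -/
lemma mlieBracket_ξ_S (hA : A.IsAntiQuasiSasakian) [T2Space M] (hX : IsSmoothField X) (x : M) :
    mlieBracket I A.ξ (fun y ↦ A.S y (X y)) x = A.S x (mlieBracket I A.ξ X x) := by
  refine inner_ext A.g fun z ↦ ?_
  obtain ⟨Z, hZ, rfl⟩ := exists_isSmoothField x z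
  have hξX := A.smooth_ξ.mlieBracket hX
  have hξZ := A.smooth_ξ.mlieBracket hZ
  have h1 := hA.killing (hA.isSmoothField_S hX) hZ x
  have h2 : pairing A.g (fun y ↦ A.S y (X y)) Z = -extDerivOneForm A.η X Z :=
    funext fun y ↦ hA.inner_S hX hZ y
  rw [h2, mvfderiv_neg, neg_apply, hA.mvfderiv_extDerivOneForm hX hZ, hA.inner_S hX hξZ] at h1
  rw [hA.inner_S hξX hZ]
  linarith

/-- The Jacobi operator of the Reeb field is `-S²`. -/
lemma jacobi_eq (hA : A.IsAntiQuasiSasakian) [T2Space M] (hX : IsSmoothField X) (x : M) :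
    A.jacobi X x = -A.S x (A.S x (X x)) := by
  have hnab : ∀ y v, leviCivita A.g A.ξ y v = -A.S y v := fun y v ↦ by simp [S]
  have hSX := hA.isSmoothField_S hX
  have hneg : leviCivita A.g (fun y ↦ -A.S y (X y)) x (A.ξ x)
      = -leviCivita A.g (fun y ↦ A.S y (X y)) x (A.ξ x) := by
    have h := (leviCivita A.g).isCovariantDerivativeOnUniv.smul_const (-1) (hSX.mdiffAt x)
    rw [neg_one_smul, neg_one_smul] at h
    exact congrArg (· (A.ξ x)) h
  have hzero : leviCivita A.g (0 : Π x : M, TangentSpace I x) x = 0 := by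
    rw [CovariantDerivative.zero]; rfl
  -- Torsion-freeness gives ∇_ξ(SX) = ∇_{SX}ξ + [ξ, SX] = -S²X + S[ξ, X]; the last term cancels
  -- against -∇_{[X, ξ]}ξ = S[X, ξ].
  have htors := (CovariantDerivative.torsion_eq_zero_iff (leviCivita A.g)).1
    (leviCivita_torsion A.g)
    (A.smooth_ξ.mdiffAt x) (hSX.mdiffAt x)
  have h0 : (fun y ↦ leviCivita A.g A.ξ y (A.ξ y)) = 0 := funext fun y ↦ by
    rw [hnab, hA.S_ξ]; simp
  have h1 : (fun y ↦ leviCivita A.g A.ξ y (X y)) = fun y ↦ -A.S y (X y) := funext fun y ↦ hnab y _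
  rw [hA.mlieBracket_ξ_S hX, hnab] at htors
  rw [jacobi, curvature, h0, h1, hneg, hzero, hnab, mlieBracket_swap_apply, map_neg, neg_neg,
    ← htors]
  simp

end AlmostContactMetricStructure.IsAntiQuasiSasakian

end Reeb

/-! ### Linear algebra of η ∧ Bⁿ -/

section LinearAlgebra

open Equiv

variable {V : Type*} [AddCommGroup V] [Module ℝ V] {ι : Type*} [Fintype ι] [DecidableEq ι]

/-- The multilinear form `η(v₀) ∏ᵢ B(vᵢ, vᵢ')`. -/
noncomputable def blockProduct (ι : Type*) [Fintype ι] [DecidableEq ι] (η : V →ₗ[ℝ] ℝ)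
    (B : V →ₗ[ℝ] V →ₗ[ℝ] ℝ) :
    MultilinearMap ℝ (fun _ : Option (ι × Bool) ↦ V) ℝ :=
  .mk' (fun v ↦ η (v none) * ∏ i, B (v (some (i, false))) (v (some (i, true))))
    (by
      intro v k x y
      rcases k with _ | ⟨i, _ | _⟩
      · simp [add_mul]
      all_goals
        simp only [← Finset.mul_prod_erase _ _ (Finset.mem_univ i)]
        have h : ∀ (z : V) (b : Bool),
            ∏ j ∈ Finset.univ.erase i, B (Function.update v (some (i, b)) z (some (j, false)))
              (Function.update v (some (i, b)) z (some (j, true)))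
            = ∏ j ∈ Finset.univ.erase i, B (v (some (j, false))) (v (some (j, true))) :=
          fun z b ↦ Finset.prod_congr rfl fun j hj ↦ by
            simp [Function.update_of_ne, Finset.ne_of_mem_erase hj]
        rw [h, h, h]
        simp [Function.update_of_ne]
        ring)
    (by
      intro v k c x
      rcases k with _ | ⟨i, _ | _⟩
      · simp [mul_assoc]
      all_goals
        simp only [← Finset.mul_prod_erase _ _ (Finset.mem_univ i)]
        have h : ∀ (z : V) (b : Bool),
            ∏ j ∈ Finset.univ.erase i, B (Function.update v (some (i, b)) z (some (j, false)))
              (Function.update v (some (i, b)) z (some (j, true)))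
            = ∏ j ∈ Finset.univ.erase i, B (v (some (j, false))) (v (some (j, true))) :=
          fun z b ↦ Finset.prod_congr rfl fun j hj ↦ by
            simp [Function.update_of_ne, Finset.ne_of_mem_erase hj]
        rw [h, h]
        simp [Function.update_of_ne]
        ring)

/-- The alternating form `η ∧ B ∧ ⋯ ∧ B`, up to a constant. -/
noncomputable def wedgePower (ι : Type*) [Fintype ι] [DecidableEq ι] (η : V →ₗ[ℝ] ℝ)
    (B : V →ₗ[ℝ] V →ₗ[ℝ] ℝ) :
    V [⋀^Option (ι × Bool)]→ₗ[ℝ] ℝ :=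
  MultilinearMap.alternatization (blockProduct ι η B)

lemma wedgePower_apply (η : V →ₗ[ℝ] ℝ) (B : V →ₗ[ℝ] V →ₗ[ℝ] ℝ) (v : Option (ι × Bool) → V) :
    wedgePower ι η B v = ∑ σ : Perm (Option (ι × Bool)), ((Perm.sign σ : ℤ) : ℝ) *
      (η (v (σ none)) * ∏ i, B (v (σ (some (i, false)))) (v (σ (some (i, true))))) := by
  rw [wedgePower, MultilinearMap.alternatization_apply]
  refine Finset.sum_congr rfl fun σ _ ↦ ?_
  rw [Units.smul_def, zsmul_eq_mul]
  rfl

/-- A nonvanishing `η ∧ B ∧ ⋯ ∧ B` of top degree excludes common null vectors of `η` and `B`. -/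
lemma eq_zero_of_wedgePower_ne_zero [FiniteDimensional ℝ V]
    (hdim : Module.finrank ℝ V = Fintype.card (Option (ι × Bool)))
    {η : V →ₗ[ℝ] ℝ} {B : V →ₗ[ℝ] V →ₗ[ℝ] ℝ} {v : Option (ι × Bool) → V}
    (hv : wedgePower ι η B v ≠ 0) {w : V} (hη : η w = 0) (hl : ∀ u, B w u = 0)
    (hr : ∀ u, B u w = 0) : w = 0 := by
  by_contra hw
  obtain ⟨f, hf⟩ := Module.Projective.exists_dual_ne_zero ℝ hw
  -- Projection killing w. Replacing v by p ∘ v changes it by multiples of w, which neither η nor B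
  -- sees; but p is not injective, so p ∘ v is dependent.
  let p : V →ₗ[ℝ] V := LinearMap.id - ((f w)⁻¹ • f).smulRight w
  have hp : ∀ u, p u = u - ((f w)⁻¹ * f u) • w := fun u ↦ by simp [p]
  have hpw : p w = 0 := by rw [hp, inv_mul_cancel₀ hf, one_smul, sub_self]
  have h1 : wedgePower ι η B (p ∘ v) = wedgePower ι η B v := by
    simp [wedgePower_apply, hp, hη, hl, hr]
  refine hv (h1 ▸ AlternatingMap.map_linearDependent _ _ fun hli ↦ hw ?_)
  have hspan := hli.span_eq_top_of_card_eq_finrank' hdim.symm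
  have hsurj : Function.Surjective p := by
    rw [← LinearMap.range_eq_top, ← top_le_iff, ← hspan, Submodule.span_le]
    rintro _ ⟨k, rfl⟩
    exact ⟨v k, rfl⟩
  exact LinearMap.injective_iff_surjective.2 hsurj (hpw.trans (map_zero p).symm)

/-- An alternating form with one-dimensional radical on a space of dimension larger than `2k + 1`
has a symplectic family of length `k + 1`. -/
lemma exists_symplectic_family [FiniteDimensional ℝ V] {B : V →ₗ[ℝ] V →ₗ[ℝ] ℝ}
    (hB : ∀ v w, B v w = -B w v) {ξ : V} (hker : ∀ w, (∀ v, B w v = 0) → ∃ c : ℝ, w = c • ξ)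
    (k : ℕ) (hk : 2 * k ≤ Module.finrank ℝ V) :
    ∃ e f : Fin k → V, (∀ i j, B (e i) (e j) = 0) ∧ (∀ i j, B (f i) (f j) = 0) ∧
      ∀ i j, B (e i) (f j) = if i = j then 1 else 0 := by
  induction k with
  | zero => exact ⟨Fin.elim0, Fin.elim0, fun i ↦ i.elim0, fun i ↦ i.elim0, fun i ↦ i.elim0⟩
  | succ k ih =>
    obtain ⟨e, f, he, hf, hef⟩ := ih (by omega)
    have hfe : ∀ i j, B (f i) (e j) = if i = j then -1 else 0 := fun i j ↦ by
      rw [hB, hef]; by_cases h : i = j <;> simp [h, eq_comm]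
    have hself : ∀ v, B v v = 0 := fun v ↦ self_eq_neg.1 (hB v v)
    -- Projection onto the B-orthogonal complement of the pairs found so far. If B is nonzero there,
    -- it supplies the next pair.
    let P : V → V := fun w ↦ w - ∑ i, B w (f i) • e i + ∑ i, B w (e i) • f i
    have hPe : ∀ w j, B (P w) (e j) = 0 := fun w j ↦ by simp [P, he, hfe]
    have hPf : ∀ w j, B (P w) (f j) = 0 := fun w j ↦ by simp [P, hf, hef]
    by_cases h : ∃ a b, B (P a) (P b) ≠ 0
    · obtain ⟨a, b, hab⟩ := h
      have heP : ∀ w j, B (e j) (P w) = 0 := fun w j ↦ by rw [hB, hPe, neg_zero]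
      have hfP : ∀ w j, B (f j) (P w) = 0 := fun w j ↦ by rw [hB, hPf, neg_zero]
      refine ⟨Fin.cons ((B (P a) (P b))⁻¹ • P a) e, Fin.cons (P b) f, ?_, ?_, ?_⟩
      · intro i j
        refine Fin.cases ?_ (fun i ↦ ?_) i <;> refine Fin.cases ?_ (fun j ↦ ?_) j <;>
          simp [he, hPe, heP, hself]
      · intro i j
        refine Fin.cases ?_ (fun i ↦ ?_) i <;> refine Fin.cases ?_ (fun j ↦ ?_) j <;>
          simp [hf, hPf, hfP, hself]
      · intro i j
        refine Fin.cases ?_ (fun i ↦ ?_) i <;> refine Fin.cases ?_ (fun j ↦ ?_) j <;>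
          simp [hef, hPf, heP, hab, Fin.succ_ne_zero, (Fin.succ_ne_zero _).symm]
    · exfalso
      push Not at h
      -- Otherwise the complement lies in the radical, so ξ and the k pairs span V, and the
      -- dimension is at most 2k + 1, contrary to 2(k + 1) ≤ dim V.
      have hP : ∀ w, ∃ c : ℝ, P w = c • ξ := fun w ↦ hker _ fun v ↦ by
        have : v = P v + ∑ i, B v (f i) • e i - ∑ i, B v (e i) • f i := by simp only [P]; abel
        rw [this]
        simp [hPe, hPf, h]
      let b : Option (Fin k × Bool) → V := fun o ↦ o.elim ξ fun p ↦ if p.2 then f p.1 else e p.1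
      have hb : ∀ o, b o ∈ Submodule.span ℝ (Set.range b) := fun o ↦ Submodule.subset_span ⟨o, rfl⟩
      have htop : Submodule.span ℝ (Set.range b) = ⊤ := by
        refine top_le_iff.1 fun w _ ↦ ?_
        obtain ⟨c, hc⟩ := hP w
        have : w = c • ξ + ∑ i, B w (f i) • e i - ∑ i, B w (e i) • f i := by
          rw [← hc]; simp only [P]; abel
        rw [this]
        refine Submodule.sub_mem _ (Submodule.add_mem _ (Submodule.smul_mem _ _ (hb none))
          (Submodule.sum_mem _ fun i _ ↦ Submodule.smul_mem _ _ ?_))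
          (Submodule.sum_mem _ fun i _ ↦ Submodule.smul_mem _ _ ?_)
        · simpa [b] using hb (some (i, false))
        · simpa [b] using hb (some (i, true))
      have hcard := finrank_range_le_card (R := ℝ) b
      rw [Set.finrank, htop, finrank_top] at hcard
      simp at hcard
      omega

/-- The permutation that permutes the pairs by `τ` and flips those singled out by `s`. -/
noncomputable def blockPerm (τ : Perm ι) (s : ι → Bool) : Perm (Option (ι × Bool)) :=
  optionCongr (prodCongrLeft (fun _ : Bool ↦ τ) * prodCongrRight fun i ↦ if s i then boolNot else 1)

/-- τ acts simultaneously on the two copies of `ι` and contributes (sign τ)² = 1, while each flip is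
a transposition. -/
lemma sign_blockPerm (τ : Perm ι) (s : ι → Bool) :
    Perm.sign (blockPerm τ s) = ∏ i, if s i then -1 else 1 := by
  have hnot : Perm.sign boolNot = -1 := by decide
  rw [blockPerm, optionCongr_sign, map_mul, Perm.sign_prodCongrLeft, Perm.sign_prodCongrRight]
  simp only [Fintype.prod_bool, Int.units_mul_self, one_mul]
  refine Finset.prod_congr rfl fun i _ ↦ ?_
  split_ifs <;> simp [hnot]

/-- A permutation that fixes the base point and preserves the pairs is a block permutation. -/
lemma exists_eq_blockPerm {σ : Perm (Option (ι × Bool))} (h0 : σ none = none)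
    (h : ∀ i, ∃ j s, σ (some (i, false)) = some (j, s) ∧
      σ (some (i, true)) = some (j, !s)) :
    ∃ τ s, σ = blockPerm τ s := by
  choose τ s hf ht using h
  have hτ : Function.Injective τ := by
    intro i j hij
    rcases eq_or_ne (s i) (s j) with hs | hs
    · have := hf i
      rw [hij, hs, ← hf j] at this
      simpa using σ.injective this
    · have := hf i
      rw [hij, Bool.eq_not.2 hs, ← ht j] at this
      simpa using σ.injective this
  refine ⟨Equiv.ofBijective τ (Finite.injective_iff_bijective.1 hτ), s, Equiv.ext fun o ↦ ?_⟩
  rcases o with _ | ⟨i, _ | _⟩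
  · simp [h0, blockPerm]
  · rw [hf]; rcases hs : s i <;> simp [blockPerm, hs]
  · rw [ht]; rcases hs : s i <;> simp [blockPerm, hs]

/-- `η ∧ B ∧ ⋯ ∧ B` does not vanish on a symplectic family completed by a vector of the radical. -/
lemma wedgePower_pos {η : V →ₗ[ℝ] ℝ} {B : V →ₗ[ℝ] V →ₗ[ℝ] ℝ} (hB : ∀ v w, B v w = -B w v)
    {v : Option (ι × Bool) → V} (hη : η (v none) = 1) (hv : ∀ w, B (v none) w = 0)
    (hs : ∀ i a j b, B (v (some (i, a))) (v (some (j, b)))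
      = if i = j then (if a = b then 0 else if a then -1 else 1) else 0) :
    0 < wedgePower ι η B v := by
  rw [wedgePower_apply]
  refine Finset.sum_pos' (fun σ _ ↦ ?_) ⟨1, Finset.mem_univ _, by simp [hη, hs]⟩
  by_cases hprod : ∏ i, B (v (σ (some (i, false)))) (v (σ (some (i, true)))) = 0
  · simp [hprod]
  rw [Finset.prod_eq_zero_iff] at hprod
  push Not at hprod
  have hv' : ∀ w, B w (v none) = 0 := fun w ↦ by rw [hB, hv, neg_zero]
  -- A nonzero product forces σ to send each pair to a pair, in one of the two orders.
  have hblock : ∀ i, ∃ j s, σ (some (i, false)) = some (j, s) ∧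
      σ (some (i, true)) = some (j, !s) := by
    intro i
    have hi := hprod i (Finset.mem_univ i)
    rcases h1 : σ (some (i, false)) with _ | ⟨j, a⟩
    · simp [h1, hv] at hi
    rcases h2 : σ (some (i, true)) with _ | ⟨j', b⟩
    · simp [h2, hv'] at hi
    rw [h1, h2, hs] at hi
    obtain rfl : j = j' := by
      by_contra hj
      simp [hj] at hi
    have hab : b ≠ a := by
      rintro rfl
      simp at hi
    exact ⟨j, a, rfl, by rw [Bool.eq_not.2 hab]⟩
  have h0 : σ none = none := by
    obtain ⟨o, ho⟩ := σ.surjective none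
    rcases o with _ | ⟨i, a⟩
    · exact ho
    · obtain ⟨j, s, h1, h2⟩ := hblock i
      cases a
      · exact absurd (h1.symm.trans ho) (by simp)
      · exact absurd (h2.symm.trans ho) (by simp)
  obtain ⟨τ, s, rfl⟩ := exists_eq_blockPerm h0 hblock
  have hterm : ∀ i, B (v (blockPerm τ s (some (i, false)))) (v (blockPerm τ s (some (i, true))))
      = if s i then -1 else 1 := fun i ↦ by
    rcases hsi : s i <;> simp [blockPerm, hsi, hs]
  -- Each flip contributes -1 to the sign of the permutation and -1 to the product, so every nonzero
  -- term of the sum is positive.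
  rw [h0, hη, sign_blockPerm, Finset.prod_congr rfl fun i _ ↦ hterm i, one_mul]
  push_cast
  rw [← Finset.prod_mul_distrib]
  refine Finset.prod_nonneg fun i _ ↦ ?_
  split_ifs <;> simp

/-- The reindexing of `2n + 1` vectors as a base point and `n` pairs. -/
noncomputable def pairIndexEquiv (n : ℕ) : Option (Fin n × Bool) ≃ Fin (2 * n + 1) where
  toFun o := o.elim 0 fun p ↦ ⟨2 * p.1 + (if p.2 then 2 else 1), by split_ifs <;> omega⟩
  invFun k := if h : (k : ℕ) = 0 then none else
    some (⟨((k : ℕ) - 1) / 2, by omega⟩, decide (((k : ℕ) - 1) % 2 = 1))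
  left_inv o := by
    rcases o with _ | ⟨i, _ | _⟩
    · simp
    · simp
    · simp [Fin.ext_iff]; omega
  right_inv k := by
    by_cases h : (k : ℕ) = 0
    · simp [h, Fin.ext_iff]
    · simp only [h, dite_false, Option.elim_some, Fin.ext_iff, decide_eq_true_eq]
      split_ifs <;> omega

lemma wedgePower_eq_sum_perm_fin {n : ℕ} (η : V →ₗ[ℝ] ℝ) (B : V →ₗ[ℝ] V →ₗ[ℝ] ℝ)
    (v : Fin (2 * n + 1) → V) :
    ∑ σ : Perm (Fin (2 * n + 1)), ((Perm.sign σ : ℤ) : ℝ) * (η (v (σ 0)) *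
      ∏ i : Fin n, B (v (σ ⟨2 * i + 1, by omega⟩)) (v (σ ⟨2 * i + 2, by omega⟩)))
      = wedgePower (Fin n) η B (v ∘ pairIndexEquiv n) := by
  rw [wedgePower_apply, ← Equiv.sum_comp (pairIndexEquiv n).permCongr]
  refine Finset.sum_congr rfl fun σ _ ↦ ?_
  rw [Perm.sign_permCongr]
  have h0 : (pairIndexEquiv n).symm 0 = none := (Equiv.symm_apply_eq _).2 rfl
  have h1 : ∀ i : Fin n, (pairIndexEquiv n).symm ⟨2 * i + 1, by omega⟩ = some (i, false) :=
    fun i ↦ (Equiv.symm_apply_eq _).2 rfl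
  have h2 : ∀ i : Fin n, (pairIndexEquiv n).symm ⟨2 * i + 2, by omega⟩ = some (i, true) :=
    fun i ↦ (Equiv.symm_apply_eq _).2 rfl
  simp [permCongr_apply, h0, h1, h2]

/-- In dimension `2n + 1`, for `B` alternating with `ξ` in its radical and `η(ξ) = 1`, the form
`η ∧ Bⁿ` does not vanish if and only if the radical of `B` is spanned by `ξ`. -/
lemma exists_wedge_ne_zero_iff [FiniteDimensional ℝ V] {n : ℕ}
    (hdim : Module.finrank ℝ V = 2 * n + 1) {η : V →ₗ[ℝ] ℝ} {B : V →ₗ[ℝ] V →ₗ[ℝ] ℝ}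
    (hB : ∀ v w, B v w = -B w v) {ξ : V} (hξ : η ξ = 1) (hBξ : ∀ w, B ξ w = 0) :
    (∃ v : Fin (2 * n + 1) → V, ∑ σ : Perm (Fin (2 * n + 1)), ((Perm.sign σ : ℤ) : ℝ) *
      (η (v (σ 0)) * ∏ i : Fin n, B (v (σ ⟨2 * i + 1, by omega⟩)) (v (σ ⟨2 * i + 2, by omega⟩)))
        ≠ 0) ↔ ∀ w, (∀ u, B w u = 0) → ∃ c : ℝ, w = c • ξ := by
  constructor
  · rintro ⟨v, hv⟩ w hw
    rw [wedgePower_eq_sum_perm_fin] at hv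
    -- If w is in the radical, w - η(w)ξ is annihilated by both η and B.
    refine ⟨η w, sub_eq_zero.1 (eq_zero_of_wedgePower_ne_zero (by simp [hdim, mul_comm]) hv
      (by simp [hξ]) (by simp [hw, hBξ]) fun u ↦ ?_)⟩
    rw [hB]
    simp [hw, hBξ]
  · intro hker
    obtain ⟨e, f, he, hf, hef⟩ := exists_symplectic_family hB hker n (by omega)
    have hfe : ∀ i j, B (f i) (e j) = if i = j then -1 else 0 := fun i j ↦ by
      rw [hB, hef]; by_cases h : i = j <;> simp [h, eq_comm]
    let b : Option (Fin n × Bool) → V := fun o ↦ o.elim ξ fun p ↦ if p.2 then f p.1 else e p.1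
    refine ⟨b ∘ (pairIndexEquiv n).symm, ?_⟩
    rw [wedgePower_eq_sum_perm_fin, Function.comp_assoc, Equiv.symm_comp_self, Function.comp_id]
    refine (wedgePower_pos hB hξ hBξ ?_).ne'
    rintro i (_ | _) j (_ | _) <;> simp [b, he, hf, hef, hfe]

end LinearAlgebra

/-! ### Ranks of S and of the Jacobi operator; the contact condition -/

section Ranks

variable {E : Type*} [NormedAddCommGroup E] [NormedSpace ℝ E] [FiniteDimensional ℝ E]
  {H : Type*} [TopologicalSpace H] {I : ModelWithCorners ℝ E H}
  {M : Type*} [TopologicalSpace M] [ChartedSpace H M] [IsManifold I ∞ M] [T2Space M]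

namespace AlmostContactMetricStructure

variable (A : AlmostContactMetricStructure I M)

/-- The bilinear form `-g(S v, w)`, which is `dη` for anti-quasi-Sasakian structures. -/
noncomputable def formS (x : M) : TangentSpace I x →ₗ[ℝ] TangentSpace I x →ₗ[ℝ] ℝ :=
  LinearMap.mk₂ ℝ (fun v w ↦ -A.g.inner x (A.S x v) w) (by intros; simp; ring) (by intros; simp)
    (by intros; simp; ring) (by intros; simp)

@[simp] lemma formS_apply (x : M) (v w : TangentSpace I x) :
    A.formS x v w = -A.g.inner x (A.S x v) w := rfl

namespace IsAntiQuasiSasakian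

variable {A}

lemma extDerivOneForm_eq (hA : A.IsAntiQuasiSasakian) {X Z : Π x : M, TangentSpace I x}
    (hX : IsSmoothField X) (hZ : IsSmoothField Z) (x : M) :
    extDerivOneForm A.η X Z x = A.formS x (X x) (Z x) := by
  simp [hA.inner_S hX hZ]

lemma formS_swap (hA : A.IsAntiQuasiSasakian) (x : M) (v w : TangentSpace I x) :
    A.formS x v w = -A.formS x w v := by
  rw [formS_apply, formS_apply, hA.inner_S_left, A.g.symm x v]

lemma S_eq_zero_iff (x : M) (v : TangentSpace I x) : A.S x v = 0 ↔ ∀ w, A.formS x v w = 0 := by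
  refine ⟨fun h w ↦ by simp [h], fun h ↦ LeviCivita.inner_ext A.g fun z ↦ ?_⟩
  simpa using h z

/-- `η` is a contact form if and only if `S` vanishes only on multiples of the Reeb field. -/
lemma isContactForm_iff (hA : A.IsAntiQuasiSasakian) {n : ℕ} (hE : Module.finrank ℝ E = 2 * n + 1) :
    IsContactForm n A.η ↔ ∀ x w, A.S x w = 0 → ∃ c : ℝ, w = c • A.ξ x := by
  refine forall_congr' fun x ↦ ?_
  simp only [S_eq_zero_iff]
  rw [← exists_wedge_ne_zero_iff (V := TangentSpace I x) (η := (A.η x : TangentSpace I x →ₗ[ℝ] ℝ))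
    (show Module.finrank ℝ (TangentSpace I x) = 2 * n + 1 from hE)
    (hA.formS_swap x) (A.η_ξ x) (by simp [hA.S_ξ])]
  constructor
  · rintro ⟨V, hV, h⟩
    refine ⟨fun i ↦ V i x, ?_⟩
    simpa only [ContinuousLinearMap.coe_coe, hA.extDerivOneForm_eq (hV _) (hV _)] using h
  · rintro ⟨v, hv⟩
    choose V hV hVx using fun i ↦ exists_isSmoothField x (v i)
    refine ⟨V, hV, ?_⟩
    simpa only [ContinuousLinearMap.coe_coe, hA.extDerivOneForm_eq (hV _) (hV _), hVx] using hv

lemma finrank_ker_eq_one {x : M} {T : TangentSpace I x →ₗ[ℝ] TangentSpace I x}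
    (h1 : T (A.ξ x) = 0) (h2 : ∀ w, T w = 0 → ∃ c : ℝ, w = c • A.ξ x) :
    Module.finrank ℝ T.ker = 1 := by
  have : T.ker = Submodule.span ℝ {A.ξ x} := by
    ext w
    rw [LinearMap.mem_ker, Submodule.mem_span_singleton]
    constructor
    · intro h
      obtain ⟨c, hc⟩ := h2 w h
      exact ⟨c, hc.symm⟩
    · rintro ⟨c, rfl⟩
      rw [map_smul, h1, smul_zero]
  rw [this, finrank_span_singleton (A.ξ_ne_zero x)]

lemma one_le_finrank_ker {x : M} {T : TangentSpace I x →ₗ[ℝ] TangentSpace I x}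
    (h1 : T (A.ξ x) = 0) : 1 ≤ Module.finrank ℝ T.ker := by
  rw [← finrank_span_singleton (K := ℝ) (A.ξ_ne_zero x)]
  refine Submodule.finrank_mono ?_
  rw [Submodule.span_singleton_le_iff_mem]
  exact h1

lemma exists_smul_of_finrank_ker_eq_one {x : M} {T : TangentSpace I x →ₗ[ℝ] TangentSpace I x}
    (h1 : T (A.ξ x) = 0) (h : Module.finrank ℝ T.ker = 1) (w : TangentSpace I x) (hw : T w = 0) :
    ∃ c : ℝ, w = c • A.ξ x := by
  have h3 : (⟨A.ξ x, h1⟩ : T.ker) ≠ 0 := fun h0 ↦ A.ξ_ne_zero x (congrArg Subtype.val h0)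
  obtain ⟨c, hc⟩ := (finrank_eq_one_iff_of_nonzero' _ h3).1 h ⟨w, hw⟩
  exact ⟨c, (congrArg Subtype.val hc).symm⟩

/-- The rank of `S` is maximal exactly when `S` vanishes only on multiples of the Reeb field. -/
lemma finrank_range_S_eq_iff (hA : A.IsAntiQuasiSasakian) {n : ℕ}
    (hE : Module.finrank ℝ E = 2 * n + 1) (x : M) :
    Module.finrank ℝ (A.S x).range = 2 * n ↔ ∀ w, A.S x w = 0 → ∃ c : ℝ, w = c • A.ξ x := by
  have h1 := LinearMap.finrank_range_add_finrank_ker (A.S x).toLinearMap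
  rw [show Module.finrank ℝ (TangentSpace I x) = 2 * n + 1 from hE] at h1
  constructor
  · intro h
    refine exists_smul_of_finrank_ker_eq_one (T := (A.S x).toLinearMap) (hA.S_ξ x) ?_
    have : Module.finrank ℝ (A.S x).toLinearMap.range = 2 * n := h
    omega
  · intro h
    have h2 := finrank_ker_eq_one (T := (A.S x).toLinearMap) (hA.S_ξ x) h
    have : Module.finrank ℝ (A.S x).toLinearMap.range = 2 * n := by omega
    exact this

lemma finrank_range_S_le (hA : A.IsAntiQuasiSasakian) {n : ℕ}
    (hE : Module.finrank ℝ E = 2 * n + 1) (x : M) :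
    Module.finrank ℝ (A.S x).range ≤ 2 * n := by
  have h1 := LinearMap.finrank_range_add_finrank_ker (A.S x).toLinearMap
  rw [show Module.finrank ℝ (TangentSpace I x) = 2 * n + 1 from hE] at h1
  have h2 := one_le_finrank_ker (T := (A.S x).toLinearMap) (hA.S_ξ x)
  have : Module.finrank ℝ (A.S x).toLinearMap.range ≤ 2 * n := by omega
  exact this

/-- The rank of the Jacobi operator is that of `S²`. -/
lemma jacobiRank_eq (hA : A.IsAntiQuasiSasakian) (x : M) :
    A.jacobiRank x
      = Module.finrank ℝ ((A.S x).toLinearMap ∘ₗ (A.S x).toLinearMap).range := by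
  have : {w : TangentSpace I x | ∃ X, IsSmoothField X ∧ A.jacobi X x = w}
      = ((A.S x).toLinearMap ∘ₗ (A.S x).toLinearMap).range := by
    ext w
    constructor
    · rintro ⟨X, hX, rfl⟩
      exact ⟨-X x, by rw [hA.jacobi_eq hX]; simp⟩
    · rintro ⟨v, rfl⟩
      obtain ⟨X, hX, hXv⟩ := exists_isSmoothField x (-v)
      exact ⟨X, hX, by rw [hA.jacobi_eq hX, hXv]; simp⟩
  rw [jacobiRank, this, Submodule.span_eq]

lemma jacobiRank_le (hA : A.IsAntiQuasiSasakian) {n : ℕ}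
    (hE : Module.finrank ℝ E = 2 * n + 1) (x : M) : A.jacobiRank x ≤ 2 * n := by
  rw [hA.jacobiRank_eq]
  exact (Submodule.finrank_mono (LinearMap.range_comp_le_range _ _)).trans
    (hA.finrank_range_S_le hE x)

/-- By skewness g(Sv, Sv) = -g(v, S²v). Thus S and S² have the same kernel, which carries maximal
rank over to the Jacobi operator. -/
lemma S_eq_zero_of_S_S_eq_zero (hA : A.IsAntiQuasiSasakian) {x : M} {v : TangentSpace I x}
    (h : A.S x (A.S x v) = 0) : A.S x v = 0 := by
  by_contra hne
  have h1 := A.g.pos x _ hne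
  rw [hA.inner_S_left, h] at h1
  simp at h1

lemma jacobiRank_eq_of_contact (hA : A.IsAntiQuasiSasakian) {n : ℕ}
    (hE : Module.finrank ℝ E = 2 * n + 1) {x : M}
    (h : ∀ w, A.S x w = 0 → ∃ c : ℝ, w = c • A.ξ x) : A.jacobiRank x = 2 * n := by
  rw [hA.jacobiRank_eq]
  have h1 := LinearMap.finrank_range_add_finrank_ker
    ((A.S x).toLinearMap ∘ₗ (A.S x).toLinearMap)
  rw [show Module.finrank ℝ (TangentSpace I x) = 2 * n + 1 from hE, finrank_ker_eq_one
    (by simp [hA.S_ξ]) fun w hw ↦ h w (hA.S_eq_zero_of_S_S_eq_zero hw)] at h1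
  omega

end IsAntiQuasiSasakian

end AlmostContactMetricStructure

end Ranks

/-! ### Unit Killing fields of a split metric on a vector space -/

section SplitMetric

set_option synthInstance.maxHeartbeats 200000

variable {V : Type*} [NormedAddCommGroup V] [NormedSpace ℝ V]

/-- A unit Killing field `ξ` of a metric `h` on an open subset `U` of a vector space, such that `h`
splits along the projection `P` and the exterior derivative of `h(ξ, ·)` has radical `ℝ ξ`. -/
structure IsSplitContactKilling (U : Set V) (P : V →L[ℝ] V) (h : V → V →L[ℝ] V →L[ℝ] ℝ)
    (ξ : V → V) : Prop where
  isOpen : IsOpen U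
  proj : ∀ a, P (P a) = P a
  contDiffOn_metric : ContDiffOn ℝ ∞ h U
  contDiffOn_field : ContDiffOn ℝ ∞ ξ U
  symm : ∀ y ∈ U, ∀ a b, h y a b = h y b a
  pos : ∀ y ∈ U, ∀ a, a ≠ 0 → 0 < h y a a
  selfAdjoint : ∀ y ∈ U, ∀ a b, h y (P a) b = h y a (P b)
  split_left : ∀ y ∈ U, ∀ a b c, fderiv ℝ h y c (P a) (P b) = fderiv ℝ h y (P c) (P a) (P b)
  split_right : ∀ y ∈ U, ∀ a b c, fderiv ℝ h y c (a - P a) (b - P b)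
    = fderiv ℝ h y (c - P c) (a - P a) (b - P b)
  killing : ∀ y ∈ U, ∀ a b,
    fderiv ℝ h y (ξ y) a b + h y (fderiv ℝ ξ y a) b + h y a (fderiv ℝ ξ y b) = 0
  unit : ∀ y ∈ U, h y (ξ y) (ξ y) = 1
  radical : ∀ y ∈ U, ∀ a, (∀ b, fderiv ℝ h y a (ξ y) b + h y (fderiv ℝ ξ y a) b
    - fderiv ℝ h y b (ξ y) a - h y (fderiv ℝ ξ y b) a = 0) → ∃ t : ℝ, a = t • ξ y

namespace IsSplitContactKilling

variable {U : Set V} {P : V →L[ℝ] V} {h : V → V →L[ℝ] V →L[ℝ] ℝ} {ξ : V → V}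

/-- The two factors play symmetric roles; this lets each later argument be given for one of them. -/
lemma complement (H : IsSplitContactKilling U P h ξ) :
    IsSplitContactKilling U (ContinuousLinearMap.id ℝ V - P) h ξ where
  __ := H
  proj a := by simp [H.proj]
  selfAdjoint y hy a b := by simp [H.selfAdjoint y hy a b]
  split_left y hy a b c := H.split_right y hy a b c
  split_right y hy a b c := by simpa using H.split_left y hy a b c

lemma hasFDerivAt_metric (H : IsSplitContactKilling U P h ξ) {y : V} (hy : y ∈ U) :
    HasFDerivAt h (fderiv ℝ h y) y :=
  ((H.contDiffOn_metric.contDiffAt (H.isOpen.mem_nhds hy)).differentiableAt (by simp)).hasFDerivAt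

lemma hasFDerivAt_field (H : IsSplitContactKilling U P h ξ) {y : V} (hy : y ∈ U) :
    HasFDerivAt ξ (fderiv ℝ ξ y) y :=
  ((H.contDiffOn_field.contDiffAt (H.isOpen.mem_nhds hy)).differentiableAt (by simp)).hasFDerivAt

lemma fderiv_metric_apply (H : IsSplitContactKilling U P h ξ) {y : V} (hy : y ∈ U) (a b c : V) :
    fderiv ℝ (fun z ↦ h z a b) y c = fderiv ℝ h y c a b := by
  have h1 := ((H.hasFDerivAt_metric hy).clm_apply (hasFDerivAt_const a y)).clm_apply
    (hasFDerivAt_const b y)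
  rw [h1.fderiv]
  simp

lemma fderiv_selfAdjoint (H : IsSplitContactKilling U P h ξ) {y : V} (hy : y ∈ U) (a b c : V) :
    fderiv ℝ h y c (P a) b = fderiv ℝ h y c a (P b) := by
  rw [← H.fderiv_metric_apply hy, ← H.fderiv_metric_apply hy]
  have hev : (fun z ↦ h z (P a) b) =ᶠ[𝓝 y] fun z ↦ h z a (P b) := by
    filter_upwards [H.isOpen.mem_nhds hy] with z hz using H.selfAdjoint z hz a b
  rw [hev.fderiv_eq]

lemma fderiv_unit (H : IsSplitContactKilling U P h ξ) {y : V} (hy : y ∈ U) (c : V) :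
    fderiv ℝ h y c (ξ y) (ξ y) + 2 * h y (ξ y) (fderiv ℝ ξ y c) = 0 := by
  have h1 := ((H.hasFDerivAt_metric hy).clm_apply (H.hasFDerivAt_field hy)).clm_apply
    (H.hasFDerivAt_field hy)
  have h2 : fderiv ℝ (fun z ↦ h z (ξ z) (ξ z)) y = 0 := by
    have : (fun z ↦ h z (ξ z) (ξ z)) =ᶠ[𝓝 y] fun _ ↦ 1 := by
      filter_upwards [H.isOpen.mem_nhds hy] with z hz using H.unit z hz
    rw [this.fderiv_eq]
    simp
  have h3 := congrArg (· c) (h1.fderiv.symm.trans h2)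
  simp at h3
  rw [H.symm y hy (fderiv ℝ ξ y c)] at h3
  linarith

lemma field_ne_zero (H : IsSplitContactKilling U P h ξ) {y : V} (hy : y ∈ U) : ξ y ≠ 0 :=
  fun h0 ↦ by
  have := H.unit y hy
  simp [h0] at this

/-- Self-adjointness of P makes the off-diagonal blocks vanish, and the P-block does not vary in the
directions of the other factor. -/
lemma fderiv_mixed_left (H : IsSplitContactKilling U P h ξ) {y : V} (hy : y ∈ U) (a b c : V) :
    fderiv ℝ h y (c - P c) (P a) b = 0 := by
  rw [← H.proj a, H.fderiv_selfAdjoint hy, H.split_left y hy, map_sub, H.proj]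
  simp

lemma fderiv_mixed_right (H : IsSplitContactKilling U P h ξ) {y : V} (hy : y ∈ U) (a b c : V) :
    fderiv ℝ h y (P c) (a - P a) b = 0 := by
  have := H.complement.fderiv_mixed_left hy a b c
  simpa using this

lemma fderiv_proj (H : IsSplitContactKilling U P h ξ) {y : V} (hy : y ∈ U) (a b c : V) :
    fderiv ℝ h y (P c) a b = fderiv ℝ h y c (P a) b := by
  have h1 := H.fderiv_mixed_left hy a b c
  have h2 := H.fderiv_mixed_right hy a b c
  rw [map_sub, sub_apply, sub_apply] at h1
  rw [map_sub, sub_apply] at h2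
  linarith

/-- The function h(ξ, Pξ), called f below, is the squared length of the component of ξ in one
factor; the argument is about its differential. -/
lemma fderiv_normSq (H : IsSplitContactKilling U P h ξ) {y : V} (hy : y ∈ U) (c : V) :
    fderiv ℝ (fun z ↦ h z (ξ z) (P (ξ z))) y c
      = fderiv ℝ h y c (ξ y) (P (ξ y)) + 2 * h y (P (ξ y)) (fderiv ℝ ξ y c) := by
  have h1 := ((H.hasFDerivAt_metric hy).clm_apply (H.hasFDerivAt_field hy)).clm_apply
    (P.hasFDerivAt.comp y (H.hasFDerivAt_field hy))
  have h2 := congrArg (· c) h1.fderiv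
  simp only [Function.comp_def] at h2
  rw [h2]
  simp
  rw [H.symm y hy (fderiv ℝ ξ y c), H.selfAdjoint y hy]
  ring

/-- The exterior derivative of `h(ξ, ·)` on `Pξ` is minus the differential of `h(ξ, Pξ)`. -/
lemma extDeriv_proj (H : IsSplitContactKilling U P h ξ) {y : V} (hy : y ∈ U) (c : V) :
    fderiv ℝ h y (P (ξ y)) (ξ y) c + h y (fderiv ℝ ξ y (P (ξ y))) c
      - fderiv ℝ h y c (ξ y) (P (ξ y)) - h y (fderiv ℝ ξ y c) (P (ξ y))
      = -fderiv ℝ (fun z ↦ h z (ξ z) (P (ξ z))) y c := by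
  have h1 := H.killing y hy (P (ξ y)) c
  rw [H.fderiv_normSq hy, H.fderiv_proj hy, H.symm y hy (fderiv ℝ ξ y c)]
  linarith

/-- Twice the Killing equation on (ξ, Pξ) minus the derivative of |ξ|² = 1 along Pξ. -/
lemma fderiv_normSq_field (H : IsSplitContactKilling U P h ξ) {y : V} (hy : y ∈ U) :
    fderiv ℝ (fun z ↦ h z (ξ z) (P (ξ z))) y (ξ y) = 0 := by
  have h1 := H.killing y hy (ξ y) (P (ξ y))
  have h2 := H.fderiv_unit hy (P (ξ y))
  rw [H.fderiv_proj hy, H.fderiv_selfAdjoint hy] at h2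
  rw [H.fderiv_normSq hy]
  rw [H.symm y hy (fderiv ℝ ξ y (ξ y))] at h1
  linarith

lemma fderiv_normSq_proj (H : IsSplitContactKilling U P h ξ) {y : V} (hy : y ∈ U) :
    fderiv ℝ (fun z ↦ h z (ξ z) (P (ξ z))) y (P (ξ y)) = 0 := by
  rw [← neg_eq_zero, ← H.extDeriv_proj hy]
  ring

/-- The Lie bracket of `Pξ` and `ξ` annihilates `h(ξ, Pξ)`. -/
lemma fderiv_normSq_bracket (H : IsSplitContactKilling U P h ξ) {y : V} (hy : y ∈ U) :
    fderiv ℝ (fun z ↦ h z (ξ z) (P (ξ z))) y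
      (fderiv ℝ ξ y (P (ξ y)) - P (fderiv ℝ ξ y (ξ y))) = 0 := by
  set f := fun z ↦ h z (ξ z) (P (ξ z))
  have hU := H.isOpen.mem_nhds hy
  have hf : ContDiffAt ℝ ∞ f y :=
    ((H.contDiffOn_metric.contDiffAt hU).clm_apply (H.contDiffOn_field.contDiffAt hU)).clm_apply
      (P.contDiff.contDiffAt.comp y (H.contDiffOn_field.contDiffAt hU))
  have hf' : HasFDerivAt (fderiv ℝ f) (fderiv ℝ (fderiv ℝ f) y) y :=
    ((hf.fderiv_right (m := 1) (by
      rw [one_add_one_eq_two]; exact WithTop.coe_le_coe.2 (le_top : (2 : ℕ∞) ≤ ⊤))).differentiableAt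
      (by simp)).hasFDerivAt
  have hsymm : IsSymmSndFDerivAt ℝ f y :=
    hf.isSymmSndFDerivAt (by simpa using WithTop.coe_le_coe.2 (le_top : (2 : ℕ∞) ≤ ⊤))
  have hzero : ∀ {g : V → ℝ}, (∀ z ∈ U, g z = 0) → fderiv ℝ g y = 0 := fun {g} hg ↦ by
    have : g =ᶠ[𝓝 y] fun _ ↦ 0 := by filter_upwards [hU] with z hz using hg z hz
    rw [this.fderiv_eq]
    simp
  -- Differentiate df(ξ) = 0 along Pξ and df(Pξ) = 0 along ξ; the second derivatives of f cancel by
  -- symmetry.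
  have h1 := congrArg (· (P (ξ y))) ((hf'.clm_apply (H.hasFDerivAt_field hy)).fderiv.symm.trans
    (hzero fun z hz ↦ H.fderiv_normSq_field hz))
  have h2 := congrArg (· (ξ y)) ((hf'.clm_apply
    (P.hasFDerivAt.comp y (H.hasFDerivAt_field hy))).fderiv.symm.trans
    (hzero fun z hz ↦ H.fderiv_normSq_proj hz))
  have h3 := hsymm (P (ξ y)) (ξ y)
  simp at h1 h2
  rw [map_sub]
  linarith

/-- The field `ξ` is tangent to one of the factors. -/
lemma proj_eq_zero_or (H : IsSplitContactKilling U P h ξ) {y : V} (hy : y ∈ U) :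
    P (ξ y) = 0 ∨ P (ξ y) = ξ y := by
  -- The bracket [Pξ, ξ]; the identity `h1` says that it is -½ grad f.
  set e := fderiv ℝ ξ y (P (ξ y)) - P (fderiv ℝ ξ y (ξ y)) with he
  have h1 : ∀ c, 2 * h y e c = -fderiv ℝ (fun z ↦ h z (ξ z) (P (ξ z))) y c := by
    intro c
    have k1 := H.killing y hy (P (ξ y)) c
    have k2 := H.killing y hy (ξ y) (P c)
    have k3 := H.fderiv_unit hy (P c)
    rw [H.fderiv_proj hy, H.fderiv_selfAdjoint hy] at k3
    rw [H.fderiv_selfAdjoint hy] at k1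
    rw [H.fderiv_normSq hy, he, map_sub, sub_apply, H.selfAdjoint y hy (fderiv ℝ ξ y (ξ y))]
    linarith
  -- The bracket annihilates f, so 2 h(e, e) = -df(e) = 0.
  have he0 : e = 0 := by
    by_contra hne
    have h2 := H.pos y hy e hne
    have h3 := h1 e
    rw [H.fderiv_normSq_bracket hy] at h3
    linarith
  -- Now df = 0, so Pξ is in the radical, Pξ = tξ, and P² = P forces t² = t.
  obtain ⟨t, ht⟩ := H.radical y hy (P (ξ y)) fun c ↦ by
    rw [H.extDeriv_proj hy, ← h1, he0]
    simp
  have h4 := H.proj (ξ y)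
  rw [ht, map_smul, ht, smul_smul, ← sub_eq_zero, ← sub_smul] at h4
  have h5 := (smul_eq_zero.1 h4).resolve_right (H.field_ne_zero hy)
  rcases mul_eq_zero.1 (show t * (t - 1) = 0 by linarith) with h6 | h6
  · left; rw [ht, h6, zero_smul]
  · right; rw [ht, sub_eq_zero.1 h6, one_smul]

/-- If ξ is tangent to the factor P, then h(ξ, ·) does not involve the other factor, whose vectors
therefore lie in the radical ℝξ; but P fixes ξ and kills them. -/
lemma false_of_proj_eq (H : IsSplitContactKilling U P h ξ) {y : V} (hy : y ∈ U)
    (hP : ∃ a, P a ≠ a) (hξ : P (ξ y) = ξ y) : False := by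
  -- Pξ ≠ 0 persists near y, so the dichotomy gives Pξ = ξ on a neighbourhood, and this identity can
  -- be differentiated.
  have hev : (fun z ↦ P (ξ z)) =ᶠ[𝓝 y] ξ := by
    have hc : ContinuousAt (fun z ↦ P (ξ z)) y :=
      (P.hasFDerivAt.comp y (H.hasFDerivAt_field hy)).continuousAt
    filter_upwards [H.isOpen.mem_nhds hy, hc.eventually_ne (hξ ▸ H.field_ne_zero hy)] with z hz hz0
      using (H.proj_eq_zero_or hz).resolve_left hz0
  have hD : ∀ c, P (fderiv ℝ ξ y c) = fderiv ℝ ξ y c := fun c ↦ by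
    have h1 := (P.hasFDerivAt.comp y (H.hasFDerivAt_field hy)).fderiv
    have h2 := hev.fderiv_eq (𝕜 := ℝ)
    exact congrArg (· c) (h1.symm.trans h2)
  obtain ⟨a, ha⟩ := hP
  have hPQ : P (a - P a) = 0 := by simp [H.proj]
  have h0 : ∀ v, h y (a - P a) (P v) = 0 := fun v ↦ by rw [← H.selfAdjoint y hy, hPQ]; simp
  have h1 : ∀ c v, fderiv ℝ h y c (P v) (a - P a) = 0 := fun c v ↦ by
    rw [H.fderiv_selfAdjoint hy, hPQ, map_zero]
  obtain ⟨t, ht⟩ := H.radical y hy (a - P a) fun c ↦ by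
    have k1 := H.killing y hy (a - P a) c
    have k2 := H.fderiv_mixed_left hy (ξ y) c a
    have k3 := H.fderiv_mixed_right hy a c (ξ y)
    have k4 := h0 (fderiv ℝ ξ y c)
    have k5 := h1 c (ξ y)
    rw [hD] at k4
    rw [hξ] at k2 k3 k5
    rw [H.symm y hy (fderiv ℝ ξ y c)]
    linarith
  rw [ht, map_smul, hξ, ← ht] at hPQ
  exact ha (sub_eq_zero.1 hPQ).symm

/-- A split metric whose two factors are nontrivial has no such field. -/
lemma eq_empty (H : IsSplitContactKilling U P h ξ) (h0 : P ≠ 0) (h1 : ∃ a, P a ≠ a) : U = ∅ := by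
  refine Set.eq_empty_of_forall_notMem fun y hy ↦ ?_
  rcases H.proj_eq_zero_or hy with hξ | hξ
  · refine H.complement.false_of_proj_eq hy ?_ (by simp [hξ])
    by_contra! hne
    exact h0 (ContinuousLinearMap.ext fun a ↦ by simpa using hne a)
  · exact H.false_of_proj_eq hy h1 hξ

end IsSplitContactKilling

end SplitMetric

/-! ### Pulling back metrics and vector fields to a vector space -/

section PullbackMetric

variable {E : Type*} [NormedAddCommGroup E] [NormedSpace ℝ E] [FiniteDimensional ℝ E]
  {H : Type*} [TopologicalSpace H] {I : ModelWithCorners ℝ E H}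
  {M : Type*} [TopologicalSpace M] [ChartedSpace H M] [IsManifold I ∞ M]
  {V : Type*} [NormedAddCommGroup V] [NormedSpace ℝ V] [FiniteDimensional ℝ V]

set_option synthInstance.maxHeartbeats 200000

/-- The pullback of a Riemannian metric by a map from a vector space. -/
noncomputable def pullMetric (g : ContMDiffRiemannianMetric I ∞ E (fun x : M ↦ TangentSpace I x))
    (G : V → M) (y : V) : V →L[ℝ] V →L[ℝ] ℝ :=
  letI D : V →L[ℝ] TangentSpace I (G y) := mfderiv 𝓘(ℝ, V) I G y
  (ContinuousLinearMap.precomp ℝ D) ∘L (g.inner (G y) ∘L D)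

variable (I) in
/-- The pullback of a vector field by a map from a vector space. -/
noncomputable def pullField (G : V → M) (X : Π x : M, TangentSpace I x) : V → V :=
  mpullback 𝓘(ℝ, V) I G X

variable {g : ContMDiffRiemannianMetric I ∞ E (fun x : M ↦ TangentSpace I x)} {G : V → M}
  {U : Set V}

lemma pullMetric_apply (y a b : V) : pullMetric g G y a b
    = g.inner (G y) (mfderiv 𝓘(ℝ, V) I G y a) (mfderiv 𝓘(ℝ, V) I G y b) := rfl

lemma contMDiffOn_mfderiv_const (hU : IsOpen U) (hG : ContMDiffOn 𝓘(ℝ, V) I ∞ G U) (a : V) :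
    ContMDiffOn 𝓘(ℝ, V) I.tangent ∞
      (fun y ↦ (⟨G y, mfderiv 𝓘(ℝ, V) I G y a⟩ : TangentBundle I M)) U := by
  have h1 := hG.contMDiffOn_tangentMapWithin (m := ∞) le_rfl hU.uniqueMDiffOn
  have h2 : ContMDiff 𝓘(ℝ, V) 𝓘(ℝ, V).tangent ∞
      (fun y : V ↦ (⟨y, a⟩ : TangentBundle 𝓘(ℝ, V) V)) := fun y ↦
    contMDiffAt_vectorSpace_iff_contDiffAt.2 contDiffAt_const
  refine (h1.comp h2.contMDiffOn (fun y hy ↦ hy)).congr fun y hy ↦ ?_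
  simp only [Function.comp_def, tangentMapWithin, mfderivWithin_of_isOpen hU hy]

lemma contDiffOn_pullMetric (hU : IsOpen U) (hG : ContMDiffOn 𝓘(ℝ, V) I ∞ G U) :
    ContDiffOn ℝ ∞ (pullMetric g G) U := by
  rw [contDiffOn_clm_apply]
  intro a
  rw [contDiffOn_clm_apply]
  intro b
  rw [← contMDiffOn_iff_contDiffOn]
  intro y hy
  have : ContMDiffWithinAt 𝓘(ℝ, V) (I.prod 𝓘(ℝ)) ∞
      (fun m ↦ TotalSpace.mk' ℝ (E := Bundle.Trivial M ℝ) (G m) (pullMetric g G m a b)) U y :=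
    ContMDiffWithinAt.clm_bundle_apply₂ (F₁ := E) (F₂ := E)
      ((g.contMDiff (G y)).comp_contMDiffWithinAt y (hG y hy))
      (contMDiffOn_mfderiv_const hU hG a y hy) (contMDiffOn_mfderiv_const hU hG b y hy)
  rw [contMDiffWithinAt_totalSpace] at this
  exact this.2

/-- Invertibility is essential: `mpullback` uses an inverse of the derivative that defaults to zero
where there is none. -/
lemma mfderiv_pullField {y : V} (hD : (mfderiv 𝓘(ℝ, V) I G y).IsInvertible)
    (X : Π x : M, TangentSpace I x) :
    mfderiv 𝓘(ℝ, V) I G y (pullField I G X y : V) = X (G y) := by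
  exact hD.self_apply_inverse _

lemma contDiffAt_pullField (hU : IsOpen U) (hG : ContMDiffOn 𝓘(ℝ, V) I ∞ G U) {y : V} (hy : y ∈ U)
    (hD : (mfderiv 𝓘(ℝ, V) I G y).IsInvertible) {X : Π x : M, TangentSpace I x}
    (hX : IsSmoothField X) :
    ContDiffAt ℝ ∞ (pullField I G X) y :=
  contMDiffAt_vectorSpace_iff_contDiffAt.1 (ContMDiffAt.mpullback_vectorField_preimage
    (hX (G y)) (hG.contMDiffAt (hU.mem_nhds hy)) hD le_rfl)

/-- The derivative of an inner product of vector fields in terms of their pullbacks. -/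
lemma mvfderiv_pairing_pullMetric (hU : IsOpen U) (hG : ContMDiffOn 𝓘(ℝ, V) I ∞ G U)
    (hD : ∀ y ∈ U, (mfderiv 𝓘(ℝ, V) I G y).IsInvertible) {X Y : Π x : M, TangentSpace I x}
    (hX : IsSmoothField X) (hY : IsSmoothField Y) {y : V} (hy : y ∈ U) (c : V) :
    mvfderiv I (LeviCivita.pairing g X Y) (G y) (mfderiv 𝓘(ℝ, V) I G y c)
      = fderiv ℝ (pullMetric g G) y c (pullField I G X y) (pullField I G Y y)
        + pullMetric g G y (fderiv ℝ (pullField I G X) y c) (pullField I G Y y)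
        + pullMetric g G y (pullField I G X y) (fderiv ℝ (pullField I G Y) y c) := by
  have hUy := hU.mem_nhds hy
  have h1 : mvfderiv I (LeviCivita.pairing g X Y) (G y) (mfderiv 𝓘(ℝ, V) I G y c)
      = mvfderiv 𝓘(ℝ, V) (LeviCivita.pairing g X Y ∘ G) y c :=
    (mvfderiv_comp_apply y ((contMDiff_pairing g hX hY).mdifferentiable (by simp) _)
      ((hG.contMDiffAt hUy).mdifferentiableAt (by simp)) c).symm
  have h2 : (LeviCivita.pairing g X Y ∘ G) =ᶠ[𝓝 y]
      fun z ↦ pullMetric g G z (pullField I G X z) (pullField I G Y z) := by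
    filter_upwards [hUy] with z hz
    rw [pullMetric_apply, mfderiv_pullField (hD z hz), mfderiv_pullField (hD z hz)]
    rfl
  have h3 : mvfderiv 𝓘(ℝ, V) (LeviCivita.pairing g X Y ∘ G) y c
      = fderiv ℝ (LeviCivita.pairing g X Y ∘ G) y c := by
    rw [← mfderiv_eq_fderiv]
    rfl
  have hX' := ((contDiffAt_pullField hU hG hy (hD y hy) hX).differentiableAt (by simp)).hasFDerivAt
  have hY' := ((contDiffAt_pullField hU hG hy (hD y hy) hY).differentiableAt (by simp)).hasFDerivAt
  have hh := (((contDiffOn_pullMetric (g := g) hU hG).contDiffAt hUy).differentiableAt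
    (by simp)).hasFDerivAt
  rw [h1, h3, h2.fderiv_eq]
  refine (congrArg (fun L : V →L[ℝ] ℝ ↦ L c) ((hh.clm_apply hX').clm_apply hY').fderiv).trans ?_
  simp
  ring

/-- The Lie bracket of vector fields in terms of their pullbacks. -/
lemma mlieBracket_eq_mfderiv (hU : IsOpen U) (hG : ContMDiffOn 𝓘(ℝ, V) I ∞ G U)
    {X Y : Π x : M, TangentSpace I x} (hX : IsSmoothField X) (hY : IsSmoothField Y) {y : V}
    (hy : y ∈ U) (hD : (mfderiv 𝓘(ℝ, V) I G y).IsInvertible) :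
    mlieBracket I X Y (G y)
      = mfderiv 𝓘(ℝ, V) I G y (fderiv ℝ (pullField I G Y) y (pullField I G X y)
        - fderiv ℝ (pullField I G X) y (pullField I G Y y)) := by
  have : IsManifold I (minSmoothness ℝ 3) M := isManifold_minSmoothness
  have h2 : minSmoothness ℝ 2 ≤ ∞ := by
    simpa using WithTop.coe_le_coe.2 (le_top : (2 : ℕ∞) ≤ ⊤)
  have h3 : ∀ W W' : Π x : V, TangentSpace 𝓘(ℝ, V) x,
      mlieBracket 𝓘(ℝ, V) W W' y = lieBracket ℝ W W' y := fun W W' ↦ by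
    rw [← mlieBracketWithin_univ, mlieBracketWithin_eq_lieBracketWithin]
    exact congrFun lieBracketWithin_univ y
  exact (mfderiv_pullField hD (mlieBracket I X Y)).symm.trans (congrArg _
    ((mpullback_mlieBracket (hX.mdiffAt _) (hY.mdiffAt _)
      (hG.contMDiffAt (hU.mem_nhds hy)) h2).trans
      (h3 _ _)))

end PullbackMetric

/-! ### The pulled-back Reeb field -/

section PullbackReeb

variable {E : Type*} [NormedAddCommGroup E] [NormedSpace ℝ E] [FiniteDimensional ℝ E]
  {H : Type*} [TopologicalSpace H] {I : ModelWithCorners ℝ E H}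
  {M : Type*} [TopologicalSpace M] [ChartedSpace H M] [IsManifold I ∞ M] [T2Space M]
  {V : Type*} [NormedAddCommGroup V] [NormedSpace ℝ V] [FiniteDimensional ℝ V]

set_option synthInstance.maxHeartbeats 200000

namespace AlmostContactMetricStructure.IsAntiQuasiSasakian

variable {A : AlmostContactMetricStructure I M} {G : V → M} {U : Set V}

lemma pullField_eq {y : V} (hD : (mfderiv 𝓘(ℝ, V) I G y).IsInvertible)
    {X : Π x : M, TangentSpace I x} {a : V} (hX : X (G y) = mfderiv 𝓘(ℝ, V) I G y a) :
    pullField I G X y = a := by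
  have h := mfderiv_pullField hD X
  rw [hX] at h
  exact hD.injective h

/-- Extend the images of a and b to smooth fields on M and pull back the Killing identity; the
derivatives of the extensions cancel between the two sides. -/
lemma pullMetric_killing (hA : A.IsAntiQuasiSasakian) (hU : IsOpen U)
    (hG : ContMDiffOn 𝓘(ℝ, V) I ∞ G U) (hD : ∀ y ∈ U, (mfderiv 𝓘(ℝ, V) I G y).IsInvertible)
    {y : V} (hy : y ∈ U) (a b : V) :
    fderiv ℝ (pullMetric A.g G) y (pullField I G A.ξ y) a b
      + pullMetric A.g G y (fderiv ℝ (pullField I G A.ξ) y a) b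
      + pullMetric A.g G y a (fderiv ℝ (pullField I G A.ξ) y b) = 0 := by
  obtain ⟨X, hX, hXa⟩ := exists_isSmoothField (G y) (mfderiv 𝓘(ℝ, V) I G y a)
  obtain ⟨Y, hY, hYb⟩ := exists_isSmoothField (G y) (mfderiv 𝓘(ℝ, V) I G y b)
  have h1 := hA.killing hX hY (G y)
  rw [mlieBracket_eq_mfderiv hU hG A.smooth_ξ hX hy (hD y hy),
    mlieBracket_eq_mfderiv hU hG A.smooth_ξ hY hy (hD y hy), hXa, hYb, ← pullMetric_apply,
    ← pullMetric_apply, ← mfderiv_pullField (hD y hy) A.ξ,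
    mvfderiv_pairing_pullMetric hU hG hD hX hY hy, pullField_eq (hD y hy) hXa,
    pullField_eq (hD y hy) hYb] at h1
  simp only [map_sub, sub_apply] at h1
  linarith

lemma pullMetric_unit (A : AlmostContactMetricStructure I M) {y : V}
    (hD : (mfderiv 𝓘(ℝ, V) I G y).IsInvertible) :
    pullMetric A.g G y (pullField I G A.ξ y) (pullField I G A.ξ y) = 1 := by
  rw [pullMetric_apply, mfderiv_pullField hD, A.inner_ξ, A.η_ξ]

/-- The hypothesis on a says that 2 dη vanishes on its image and any other vector, so S kills this
image. -/
lemma pullMetric_radical (hA : A.IsAntiQuasiSasakian) (hU : IsOpen U)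
    (hG : ContMDiffOn 𝓘(ℝ, V) I ∞ G U) (hD : ∀ y ∈ U, (mfderiv 𝓘(ℝ, V) I G y).IsInvertible)
    (hS : ∀ x w, A.S x w = 0 → ∃ c : ℝ, w = c • A.ξ x)
    {y : V} (hy : y ∈ U) (a : V)
    (ha : ∀ b, fderiv ℝ (pullMetric A.g G) y a (pullField I G A.ξ y) b
      + pullMetric A.g G y (fderiv ℝ (pullField I G A.ξ) y a) b
      - fderiv ℝ (pullMetric A.g G) y b (pullField I G A.ξ y) a
      - pullMetric A.g G y (fderiv ℝ (pullField I G A.ξ) y b) a = 0) :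
    ∃ t : ℝ, a = t • pullField I G A.ξ y := by
  have h0 : A.S (G y) (mfderiv 𝓘(ℝ, V) I G y a) = 0 := by
    refine LeviCivita.inner_ext A.g fun z ↦ ?_
    obtain ⟨X, hX, hXa⟩ := exists_isSmoothField (G y) (mfderiv 𝓘(ℝ, V) I G y a)
    obtain ⟨b, hb⟩ : ∃ b : V, mfderiv 𝓘(ℝ, V) I G y b = z := (hD y hy).surjective z
    obtain ⟨Y, hY, hYb⟩ := exists_isSmoothField (G y) z
    have hb' : pullField I G Y y = b := pullField_eq (hD y hy) (hYb.trans hb.symm)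
    have ha' : pullField I G X y = a := pullField_eq (hD y hy) hXa
    have h1 := hA.inner_S hX hY (G y)
    have e1 : mvfderiv I (LeviCivita.pairing A.g A.ξ X) (G y) (Y (G y)) = _ :=
      (congrArg _ (hYb.trans hb.symm)).trans
        (mvfderiv_pairing_pullMetric hU hG hD A.smooth_ξ hX hy b)
    have e2 : mvfderiv I (LeviCivita.pairing A.g A.ξ Y) (G y) (X (G y)) = _ :=
      (congrArg _ hXa).trans (mvfderiv_pairing_pullMetric hU hG hD A.smooth_ξ hY hy a)
    have e3 : A.η (G y) (mlieBracket I X Y (G y)) = pullMetric A.g G y (pullField I G A.ξ y)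
        (fderiv ℝ (pullField I G Y) y a - fderiv ℝ (pullField I G X) y b) := by
      rw [← A.ξ_inner, mlieBracket_eq_mfderiv hU hG hX hY hy (hD y hy),
        ← mfderiv_pullField (hD y hy) A.ξ, ← pullMetric_apply, ha', hb']
    rw [ha'] at e1
    rw [hb'] at e2
    rw [extDerivOneForm, ← A.pairing_ξ, ← A.pairing_ξ, LeviCivita.pairing_comm A.g Y,
      LeviCivita.pairing_comm A.g X, e1, e2, e3, map_sub, hXa, hYb] at h1
    have h2 := ha b
    rw [h1, map_zero, zero_apply]
    linarith
  obtain ⟨c, hc⟩ := hS _ _ h0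
  refine ⟨c, (hD y hy).injective (hc.trans ?_)⟩
  rw [← mfderiv_pullField (hD y hy) A.ξ]
  exact (map_smul (mfderiv 𝓘(ℝ, V) I G y) c (pullField I G A.ξ y)).symm

/-- The pullback of an anti-quasi-Sasakian contact structure along which the metric splits. -/
lemma isSplitContactKilling (hA : A.IsAntiQuasiSasakian) (hU : IsOpen U)
    (hG : ContMDiffOn 𝓘(ℝ, V) I ∞ G U) (hD : ∀ y ∈ U, (mfderiv 𝓘(ℝ, V) I G y).IsInvertible)
    (hS : ∀ x w, A.S x w = 0 → ∃ c : ℝ, w = c • A.ξ x) {P : V →L[ℝ] V} (hP : ∀ a, P (P a) = P a)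
    (hself : ∀ y ∈ U, ∀ a b, pullMetric A.g G y (P a) b = pullMetric A.g G y a (P b))
    (hl : ∀ y ∈ U, ∀ a b c, fderiv ℝ (pullMetric A.g G) y c (P a) (P b)
      = fderiv ℝ (pullMetric A.g G) y (P c) (P a) (P b))
    (hr : ∀ y ∈ U, ∀ a b c, fderiv ℝ (pullMetric A.g G) y c (a - P a) (b - P b)
      = fderiv ℝ (pullMetric A.g G) y (c - P c) (a - P a) (b - P b)) :
    IsSplitContactKilling U P (pullMetric A.g G) (pullField I G A.ξ) where
  isOpen := hU
  proj := hP
  contDiffOn_metric := contDiffOn_pullMetric hU hG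
  contDiffOn_field y hy := (contDiffAt_pullField hU hG hy (hD y hy) A.smooth_ξ).contDiffWithinAt
  symm _ _ _ _ := A.g.symm _ _ _
  pos y hy _ ha := A.g.pos _ _ fun h ↦ ha ((hD y hy).injective (h.trans (map_zero _).symm))
  selfAdjoint := hself
  split_left := hl
  split_right := hr
  killing _ hy a b := hA.pullMetric_killing hU hG hD hy a b
  unit y hy := pullMetric_unit A (hD y hy)
  radical _ hy a ha := hA.pullMetric_radical hU hG hD hS hy a ha

end AlmostContactMetricStructure.IsAntiQuasiSasakian

end PullbackReeb

/-! ### Product parametrizations and the product metric -/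

section ProductMetric

set_option synthInstance.maxHeartbeats 200000

lemma injective_mfderiv_extChartAt_symm {p : ℕ} {N : Type*} [TopologicalSpace N]
    [ChartedSpace (EuclideanSpace ℝ (Fin p)) N] [IsManifold (𝓡 p) ∞ N] {a : N}
    {y : EuclideanSpace ℝ (Fin p)} (hy : y ∈ (extChartAt (𝓡 p) a).target) :
    Function.Injective (mfderiv 𝓘(ℝ, EuclideanSpace ℝ (Fin p)) (𝓡 p)
      (extChartAt (𝓡 p) a).symm y) := by
  have : IsManifold (𝓡 p) 1 N := IsManifold.of_le (n := ∞) (by simp)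
  have h := isInvertible_mfderivWithin_extChartAt_symm hy
  rw [(𝓡 p).range_eq_univ, mfderivWithin_univ] at h
  exact h.injective

/-- The composition of a map on a product with a product of parametrizations of the factors. -/
noncomputable def productParam {p q : ℕ} {M M₁ M₂ : Type*} (F : M₁ × M₂ → M)
    (ψ₁ : EuclideanSpace ℝ (Fin p) → M₁) (ψ₂ : EuclideanSpace ℝ (Fin q) → M₂)
    (y : EuclideanSpace ℝ (Fin p) × EuclideanSpace ℝ (Fin q)) : M := F (ψ₁ y.1, ψ₂ y.2)

variable {m p q : ℕ} {M M₁ M₂ : Type*} [TopologicalSpace M]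
  [ChartedSpace (EuclideanSpace ℝ (Fin m)) M] [IsManifold (𝓡 m) ∞ M]
  [TopologicalSpace M₁] [ChartedSpace (EuclideanSpace ℝ (Fin p)) M₁] [IsManifold (𝓡 p) ∞ M₁]
  [TopologicalSpace M₂] [ChartedSpace (EuclideanSpace ℝ (Fin q)) M₂] [IsManifold (𝓡 q) ∞ M₂]
  {g₁ : ContMDiffRiemannianMetric (𝓡 p) ∞ (EuclideanSpace ℝ (Fin p))
    (fun x : M₁ ↦ TangentSpace (𝓡 p) x)}
  {g₂ : ContMDiffRiemannianMetric (𝓡 q) ∞ (EuclideanSpace ℝ (Fin q))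
    (fun x : M₂ ↦ TangentSpace (𝓡 q) x)}
  {g : ContMDiffRiemannianMetric (𝓡 m) ∞ (EuclideanSpace ℝ (Fin m))
    (fun x : M ↦ TangentSpace (𝓡 m) x)}
  {F : M₁ × M₂ → M} {ψ₁ : EuclideanSpace ℝ (Fin p) → M₁} {ψ₂ : EuclideanSpace ℝ (Fin q) → M₂}
  {U₁ : Set (EuclideanSpace ℝ (Fin p))} {U₂ : Set (EuclideanSpace ℝ (Fin q))}

lemma contMDiffOn_productParam (hF : ContMDiff ((𝓡 p).prod (𝓡 q)) (𝓡 m) ∞ F)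
    (h₁ : ContMDiffOn 𝓘(ℝ, EuclideanSpace ℝ (Fin p)) (𝓡 p) ∞ ψ₁ U₁)
    (h₂ : ContMDiffOn 𝓘(ℝ, EuclideanSpace ℝ (Fin q)) (𝓡 q) ∞ ψ₂ U₂) :
    ContMDiffOn 𝓘(ℝ, EuclideanSpace ℝ (Fin p) × EuclideanSpace ℝ (Fin q)) (𝓡 m) ∞
      (productParam F ψ₁ ψ₂) (U₁ ×ˢ U₂) :=
  hF.comp_contMDiffOn
    ((h₁.comp contDiff_fst.contMDiff.contMDiffOn fun _ hy ↦ hy.1).prodMk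
      (h₂.comp contDiff_snd.contMDiff.contMDiffOn fun _ hy ↦ hy.2))

lemma mfderiv_productParam (hF : ContMDiff ((𝓡 p).prod (𝓡 q)) (𝓡 m) ∞ F)
    {y : EuclideanSpace ℝ (Fin p) × EuclideanSpace ℝ (Fin q)}
    (h₁ : MDifferentiableAt 𝓘(ℝ, EuclideanSpace ℝ (Fin p)) (𝓡 p) ψ₁ y.1)
    (h₂ : MDifferentiableAt 𝓘(ℝ, EuclideanSpace ℝ (Fin q)) (𝓡 q) ψ₂ y.2)
    (v : EuclideanSpace ℝ (Fin p) × EuclideanSpace ℝ (Fin q)) :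
    mfderiv 𝓘(ℝ, EuclideanSpace ℝ (Fin p) × EuclideanSpace ℝ (Fin q)) (𝓡 m)
      (productParam F ψ₁ ψ₂) y v
      = mfderiv ((𝓡 p).prod (𝓡 q)) (𝓡 m) F (ψ₁ y.1, ψ₂ y.2)
        (mfderiv 𝓘(ℝ, EuclideanSpace ℝ (Fin p)) (𝓡 p) ψ₁ y.1 v.1,
          mfderiv 𝓘(ℝ, EuclideanSpace ℝ (Fin q)) (𝓡 q) ψ₂ y.2 v.2) := by
  have hf : HasMFDerivAt 𝓘(ℝ, EuclideanSpace ℝ (Fin p) × EuclideanSpace ℝ (Fin q))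
      𝓘(ℝ, EuclideanSpace ℝ (Fin p)) (Prod.fst : _ × EuclideanSpace ℝ (Fin q) → _) y
      (ContinuousLinearMap.fst ℝ (EuclideanSpace ℝ (Fin p)) (EuclideanSpace ℝ (Fin q))) :=
    hasFDerivAt_fst.hasMFDerivAt
  have hs : HasMFDerivAt 𝓘(ℝ, EuclideanSpace ℝ (Fin p) × EuclideanSpace ℝ (Fin q))
      𝓘(ℝ, EuclideanSpace ℝ (Fin q)) (Prod.snd : EuclideanSpace ℝ (Fin p) × _ → _) y
      (ContinuousLinearMap.snd ℝ (EuclideanSpace ℝ (Fin p)) (EuclideanSpace ℝ (Fin q))) :=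
    hasFDerivAt_snd.hasMFDerivAt
  have h := HasMFDerivAt.comp y (hF.mdifferentiable (by simp) (ψ₁ y.1, ψ₂ y.2)).hasMFDerivAt
    ((h₁.hasMFDerivAt.comp y hf).prodMk (h₂.hasMFDerivAt.comp y hs))
  exact congrArg (fun L : EuclideanSpace ℝ (Fin p) × EuclideanSpace ℝ (Fin q) →L[ℝ]
    EuclideanSpace ℝ (Fin m) ↦ L v) h.mfderiv

lemma pullMetric_productParam (hF : IsProductIsometry g₁ g₂ g F)
    {y : EuclideanSpace ℝ (Fin p) × EuclideanSpace ℝ (Fin q)}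
    (h₁ : MDifferentiableAt 𝓘(ℝ, EuclideanSpace ℝ (Fin p)) (𝓡 p) ψ₁ y.1)
    (h₂ : MDifferentiableAt 𝓘(ℝ, EuclideanSpace ℝ (Fin q)) (𝓡 q) ψ₂ y.2)
    (v w : EuclideanSpace ℝ (Fin p) × EuclideanSpace ℝ (Fin q)) :
    pullMetric g (productParam F ψ₁ ψ₂) y v w
      = pullMetric g₁ ψ₁ y.1 v.1 w.1 + pullMetric g₂ ψ₂ y.2 v.2 w.2 := by
  rw [pullMetric_apply, mfderiv_productParam hF.smooth h₁ h₂, mfderiv_productParam hF.smooth h₁ h₂]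
  exact hF.isometric _ _ _ _ _ _

lemma pullMetric_pos {p : ℕ} {N : Type*} [TopologicalSpace N]
    [ChartedSpace (EuclideanSpace ℝ (Fin p)) N] [IsManifold (𝓡 p) ∞ N]
    {k : ContMDiffRiemannianMetric (𝓡 p) ∞ (EuclideanSpace ℝ (Fin p))
      (fun x : N ↦ TangentSpace (𝓡 p) x)}
    {ψ : EuclideanSpace ℝ (Fin p) → N} {y : EuclideanSpace ℝ (Fin p)}
    (h : Function.Injective (mfderiv 𝓘(ℝ, EuclideanSpace ℝ (Fin p)) (𝓡 p) ψ y))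
    {v : EuclideanSpace ℝ (Fin p)} (hv : v ≠ 0) : 0 < pullMetric k ψ y v v :=
  k.pos _ _ fun h0 ↦ hv (h (h0.trans (map_zero _).symm))

lemma pullMetric_nonneg {p : ℕ} {N : Type*} [TopologicalSpace N]
    [ChartedSpace (EuclideanSpace ℝ (Fin p)) N] [IsManifold (𝓡 p) ∞ N]
    {k : ContMDiffRiemannianMetric (𝓡 p) ∞ (EuclideanSpace ℝ (Fin p))
      (fun x : N ↦ TangentSpace (𝓡 p) x)}
    {ψ : EuclideanSpace ℝ (Fin p) → N} (y v : EuclideanSpace ℝ (Fin p)) :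
    0 ≤ pullMetric k ψ y v v := by
  rw [pullMetric_apply]
  by_cases h : mfderiv 𝓘(ℝ, EuclideanSpace ℝ (Fin p)) (𝓡 p) ψ y v = 0
  · rw [h, map_zero]
  · exact (k.pos _ _ h).le

/-- A kernel vector has length zero in both positive definite summands, so the derivative is
injective; p + q = m then makes it bijective. -/
lemma isInvertible_mfderiv_productParam (hF : IsProductIsometry g₁ g₂ g F)
    {y : EuclideanSpace ℝ (Fin p) × EuclideanSpace ℝ (Fin q)}
    (h₁ : MDifferentiableAt 𝓘(ℝ, EuclideanSpace ℝ (Fin p)) (𝓡 p) ψ₁ y.1)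
    (h₂ : MDifferentiableAt 𝓘(ℝ, EuclideanSpace ℝ (Fin q)) (𝓡 q) ψ₂ y.2)
    (hi₁ : Function.Injective (mfderiv 𝓘(ℝ, EuclideanSpace ℝ (Fin p)) (𝓡 p) ψ₁ y.1))
    (hi₂ : Function.Injective (mfderiv 𝓘(ℝ, EuclideanSpace ℝ (Fin q)) (𝓡 q) ψ₂ y.2)) :
    (mfderiv 𝓘(ℝ, EuclideanSpace ℝ (Fin p) × EuclideanSpace ℝ (Fin q)) (𝓡 m)
      (productParam F ψ₁ ψ₂) y).IsInvertible := by
  let D : EuclideanSpace ℝ (Fin p) × EuclideanSpace ℝ (Fin q) →L[ℝ] EuclideanSpace ℝ (Fin m) :=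
    mfderiv 𝓘(ℝ, EuclideanSpace ℝ (Fin p) × EuclideanSpace ℝ (Fin q)) (𝓡 m)
      (productParam F ψ₁ ψ₂) y
  have hD : Function.Injective D := by
    rw [injective_iff_map_eq_zero]
    intro v hv
    have h0 := pullMetric_productParam hF h₁ h₂ v v
    have h0' : pullMetric g (productParam F ψ₁ ψ₂) y v v = 0 := by
      refine (congrArg (fun w : EuclideanSpace ℝ (Fin m) ↦
        (g.inner (productParam F ψ₁ ψ₂ y) w : EuclideanSpace ℝ (Fin m) →L[ℝ] ℝ) w) hv).trans ?_
      exact map_zero _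
    by_contra hne
    by_cases hv1 : v.1 = 0
    · have hv2 : v.2 ≠ 0 := fun h ↦ hne (Prod.ext hv1 h)
      have := pullMetric_pos (k := g₂) hi₂ hv2
      linarith [pullMetric_nonneg (k := g₁) (ψ := ψ₁) y.1 v.1]
    · have := pullMetric_pos (k := g₁) hi₁ hv1
      linarith [pullMetric_nonneg (k := g₂) (ψ := ψ₂) y.2 v.2]
  have hd : Module.finrank ℝ (EuclideanSpace ℝ (Fin p) × EuclideanSpace ℝ (Fin q))
      = Module.finrank ℝ (EuclideanSpace ℝ (Fin m)) := by
    simp [hF.dim_eq]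
  exact ⟨(LinearMap.linearEquivOfInjective D.toLinearMap hD hd).toContinuousLinearEquiv, rfl⟩

end ProductMetric

/-! ### Local irreducibility -/

section Irreducible

set_option synthInstance.maxHeartbeats 200000

/-- The derivative of a metric on a product that splits on two constant vectors. -/
lemma fderiv_metric_apply_comp {V W : Type*} [NormedAddCommGroup V] [NormedSpace ℝ V]
    [NormedAddCommGroup W] [NormedSpace ℝ W] {h : V → V →L[ℝ] V →L[ℝ] ℝ}
    {k : W → W →L[ℝ] W →L[ℝ] ℝ} {L : V →L[ℝ] W} {y : V} (hh : DifferentiableAt ℝ h y)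
    (hk : DifferentiableAt ℝ k (L y)) {a b : V} {a' b' : W}
    (he : ∀ᶠ z in 𝓝 y, h z a b = k (L z) a' b') (c : V) :
    fderiv ℝ h y c a b = fderiv ℝ k (L y) (L c) a' b' := by
  have h1 := ((hh.hasFDerivAt.clm_apply (hasFDerivAt_const a y)).clm_apply
    (hasFDerivAt_const b y)).congr_of_eventuallyEq (Filter.EventuallyEq.symm he)
  have hc : HasFDerivAt (fun z ↦ k (L z)) (fderiv ℝ k (L y) ∘L L) y :=
    HasFDerivAt.comp (g := k) (f := L) y hk.hasFDerivAt L.hasFDerivAt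
  have h2 := (hc.clm_apply (hasFDerivAt_const a' y)).clm_apply (hasFDerivAt_const b' y)
  simpa using congr($(h1.unique h2) c)

/-- In product charts the metric is block diagonal, each block depending only on its own variables,
so `eq_empty` would make the nonempty chart domain empty. -/
theorem AlmostContactMetricStructure.IsAntiQuasiSasakian.isLocallyIrreducible {m : ℕ} {M : Type*}
    [TopologicalSpace M] [T2Space M] [ChartedSpace (EuclideanSpace ℝ (Fin m)) M]
    [IsManifold (𝓡 m) ∞ M] {A : AlmostContactMetricStructure (𝓡 m) M}
    (hA : A.IsAntiQuasiSasakian)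
    (hS : ∀ x w, A.S x w = 0 → ∃ c : ℝ, w = c • A.ξ x) : IsLocallyIrreducible A.g := by
  intro p q M₁ M₂ _ _ _ _ _ _ hn₁ hn₂ g₁ g₂ F hp hq hF
  obtain ⟨a₀⟩ := hn₁
  obtain ⟨b₀⟩ := hn₂
  set ψ₁ := (extChartAt (𝓡 p) a₀).symm with hψ₁
  set ψ₂ := (extChartAt (𝓡 q) b₀).symm with hψ₂
  set U₁ := (extChartAt (𝓡 p) a₀).target with hU₁
  set U₂ := (extChartAt (𝓡 q) b₀).target with hU₂
  have ho₁ : IsOpen U₁ := isOpen_extChartAt_target a₀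
  have ho₂ : IsOpen U₂ := isOpen_extChartAt_target b₀
  have hs₁ : ContMDiffOn 𝓘(ℝ, EuclideanSpace ℝ (Fin p)) (𝓡 p) ∞ ψ₁ U₁ :=
    contMDiffOn_extChartAt_symm a₀
  have hs₂ : ContMDiffOn 𝓘(ℝ, EuclideanSpace ℝ (Fin q)) (𝓡 q) ∞ ψ₂ U₂ :=
    contMDiffOn_extChartAt_symm b₀
  have hd₁ := fun y (hy : y ∈ U₁) ↦
    (hs₁.contMDiffAt (ho₁.mem_nhds hy)).mdifferentiableAt (by simp)
  have hd₂ := fun y (hy : y ∈ U₂) ↦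
    (hs₂.contMDiffAt (ho₂.mem_nhds hy)).mdifferentiableAt (by simp)
  have hU : IsOpen (U₁ ×ˢ U₂) := ho₁.prod ho₂
  have hG := contMDiffOn_productParam hF.smooth hs₁ hs₂
  have hm := contDiffOn_pullMetric (g := A.g) hU hG
  have hmetric : ∀ y ∈ U₁ ×ˢ U₂, ∀ v w, pullMetric A.g (productParam F ψ₁ ψ₂) y v w
      = pullMetric g₁ ψ₁ y.1 v.1 w.1 + pullMetric g₂ ψ₂ y.2 v.2 w.2 := fun y hy v w ↦
    pullMetric_productParam hF (hd₁ _ hy.1) (hd₂ _ hy.2) v w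
  have hl : ∀ y ∈ U₁ ×ˢ U₂, ∀ a b c,
      fderiv ℝ (pullMetric A.g (productParam F ψ₁ ψ₂)) y c (a, 0) (b, 0)
        = fderiv ℝ (pullMetric g₁ ψ₁) y.1 c.1 a b := fun y hy a b c ↦
    fderiv_metric_apply_comp (L := ContinuousLinearMap.fst ℝ _ _)
      ((hm.contDiffAt (hU.mem_nhds hy)).differentiableAt (by simp))
      (((contDiffOn_pullMetric ho₁ hs₁).contDiffAt (ho₁.mem_nhds hy.1)).differentiableAt (by simp))
      (by filter_upwards [hU.mem_nhds hy] with z hz; simp [hmetric z hz]) c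
  have hr : ∀ y ∈ U₁ ×ˢ U₂, ∀ a b c,
      fderiv ℝ (pullMetric A.g (productParam F ψ₁ ψ₂)) y c (0, a) (0, b)
        = fderiv ℝ (pullMetric g₂ ψ₂) y.2 c.2 a b := fun y hy a b c ↦
    fderiv_metric_apply_comp (L := ContinuousLinearMap.snd ℝ _ _)
      ((hm.contDiffAt (hU.mem_nhds hy)).differentiableAt (by simp))
      (((contDiffOn_pullMetric ho₂ hs₂).contDiffAt (ho₂.mem_nhds hy.2)).differentiableAt (by simp))
      (by filter_upwards [hU.mem_nhds hy] with z hz; simp [hmetric z hz]) c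
  have H := hA.isSplitContactKilling hU hG
    (fun y hy ↦ isInvertible_mfderiv_productParam hF (hd₁ _ hy.1) (hd₂ _ hy.2)
      (injective_mfderiv_extChartAt_symm hy.1) (injective_mfderiv_extChartAt_symm hy.2)) hS
    -- P is (v, w) ↦ (v, 0); it is neither 0 nor the identity since p, q ≥ 1.
    (P := ContinuousLinearMap.inl ℝ _ _ ∘L ContinuousLinearMap.fst ℝ _ _)
    (fun a ↦ rfl) (fun y hy a b ↦ by simp [hmetric y hy])
    (fun y hy a b c ↦ by simp [hl y hy]) (fun y hy a b c ↦ by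
      have h0 : ∀ a : EuclideanSpace ℝ (Fin p) × EuclideanSpace ℝ (Fin q),
        a - (a.1, 0) = (0, a.2) := fun a ↦ by ext <;> simp
      simp [h0, hr y hy])
  have : Nonempty (Fin p) := ⟨⟨0, hp⟩⟩
  have : Nonempty (Fin q) := ⟨⟨0, hq⟩⟩
  obtain ⟨v, hv⟩ := exists_ne (0 : EuclideanSpace ℝ (Fin p))
  obtain ⟨w, hw⟩ := exists_ne (0 : EuclideanSpace ℝ (Fin q))
  have hempty := H.eq_empty (fun h ↦ hv (by simpa using congr($h (v, 0))))
    ⟨(0, w), fun h ↦ hw (by simpa using congr(($h).2).symm)⟩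
  have hmem : (extChartAt (𝓡 p) a₀ a₀, extChartAt (𝓡 q) b₀ b₀) ∈ U₁ ×ˢ U₂ :=
    ⟨mem_extChartAt_target a₀, mem_extChartAt_target b₀⟩
  rw [hempty] at hmem
  exact hmem

end Irreducible

/-! ### The main theorem -/

theorem mainTheorem4 (n : ℕ) (hn : 1 ≤ n) (M : Type*) [TopologicalSpace M] [T2Space M]
    [SecondCountableTopology M] [ConnectedSpace M]
    [ChartedSpace (EuclideanSpace ℝ (Fin (2 * n + 1))) M] [IsManifold (𝓡 (2 * n + 1)) ∞ M]
    (A : AlmostContactMetricStructure (𝓡 (2 * n + 1)) M) (hA : A.IsAntiQuasiSasakian) :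
    -- `g(J_ξ X, Z) = -g(X, S_ξ² Z)`
    (∀ X Z : Π x : M, TangentSpace (𝓡 (2 * n + 1)) x, IsSmoothField X → IsSmoothField Z →
      ∀ x, A.g.inner x (A.jacobi X x) (Z x) = -A.g.inner x (X x) (A.S x (A.S x (Z x)))) ∧
    -- `J_ξ` is symmetric and positive semi-definite
    (∀ X Z : Π x : M, TangentSpace (𝓡 (2 * n + 1)) x, IsSmoothField X → IsSmoothField Z →
      ∀ x, A.g.inner x (A.jacobi X x) (Z x) = A.g.inner x (X x) (A.jacobi Z x)) ∧
    (∀ X : Π x : M, TangentSpace (𝓡 (2 * n + 1)) x, IsSmoothField X →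
      ∀ x, 0 ≤ A.g.inner x (A.jacobi X x) (X x)) ∧
    -- the ranks of `S_ξ` and `J_ξ` never exceed `2n`
    (∀ x, Module.finrank ℝ (A.S x).range ≤ 2 * n ∧ A.jacobiRank x ≤ 2 * n) ∧
    -- `η` is a contact form exactly when `S_ξ` has maximal rank everywhere
    (IsContactForm n A.η ↔ ∀ x, Module.finrank ℝ (A.S x).range = 2 * n) ∧
    -- if `η` is a contact form, then `J_ξ` has maximal rank and `M` is irreducible, even locally
    (IsContactForm n A.η → (∀ x, A.jacobiRank x = 2 * n) ∧ IsLocallyIrreducible A.g) := by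
  have hE : Module.finrank ℝ (EuclideanSpace ℝ (Fin (2 * n + 1))) = 2 * n + 1 := by simp
  -- The form g(J_ξ X, Z) = g(SX, SZ) makes symmetry and non-negativity evident.
  have hJ : ∀ X Z : Π x : M, TangentSpace (𝓡 (2 * n + 1)) x, IsSmoothField X →
      ∀ x, A.g.inner x (A.jacobi X x) (Z x) = A.g.inner x (A.S x (X x)) (A.S x (Z x)) :=
    fun X Z hX x ↦ by rw [hA.jacobi_eq hX, map_neg, neg_apply, hA.inner_S_left, neg_neg]
  refine ⟨fun X Z hX hZ x ↦ ?_, fun X Z hX hZ x ↦ ?_, fun X hX x ↦ ?_, fun x ↦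
    ⟨hA.finrank_range_S_le hE x, hA.jacobiRank_le hE x⟩, ?_, fun h ↦ ?_⟩
  · rw [hJ X Z hX, hA.inner_S_left]
  · rw [hJ X Z hX, A.g.symm x (X x), hJ Z X hZ, A.g.symm]
  · rw [hJ X X hX]
    by_cases h : A.S x (X x) = 0
    · rw [h, map_zero]
    · exact (A.g.pos _ _ h).le
  · rw [hA.isContactForm_iff hE]
    exact forall_congr' fun x ↦ (hA.finrank_range_S_eq_iff hE x).symm
  · have hS := (hA.isContactForm_iff hE).1 h
    exact ⟨fun x ↦ hA.jacobiRank_eq_of_contact hE (hS x), hA.isLocallyIrreducible hS⟩
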